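/- Let $\langle \mathcal A \,\|\, \mathcal R\rangle$ be a group presentation, where $\mathcal A=\{a_1,\dots,a_m\}$ is a finite alphabet and $\mathcal R$ is a (possibly infinite) set of nonempty cyclically reduced words over $\mathcal A^{\pm1}$. Assume that $\mathcal R$ is decidable, i.e. there is an algorithm which decides whether a given word over $\mathcal A^{\pm1}$ belongs to $\mathcal R$. Let $\langle\langle\mathcal R\rangle\rangle$ be the normal closure of $\mathcal R$ in the free group $F(\mathcal A)$. A van Kampen diagram over the presentation is a planar, finite, connected and simply connected 2-complex $\Delta$ whose oriented edges $e$ are labelled by letters $\varphi(e)\in\mathcal A^{\pm1}$ with $\varphi(e^{-1})=\varphi(e)^{-1}$, so that the label of the boundary path of every 2-cell is, as a cyclic word, $R$ or $R^{-1}$ for some $R\in\mathcal R$. For a (not necessarily reduced) word $W$ over $\mathcal A^{\pm1}$ that represents an element of $\langle\langle\mathcal R\rangle\rangle$, let $L_1(W)$ be the least number of edges (1-cells) of a van Kampen diagram whose boundary path is labelled, literally, by the cyclic word $W$. The Dehn 1-function of the presentation is $$f_1(x)=\max\{L_1(W) : W \text{ represents an element of } \langle\langle\mathcal R\rangle\rangle,\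 |W|\le x\},$$ where $|W|$ is the length of the word $W$. Then the word problem for $\langle \mathcal A \,\|\, \mathcal R\rangle$ is solvable (there is an algorithm which decides whether a given word over $\mathcal A^{\pm1}$ represents an element of $\langle\langle\mathcal R\rangle\rangle$) if and only if the function $f_1$ is computable. -/

import Mathlib

namespace VanKampen

/-- The combinatorial data of a finite graph drawn on a closed oriented surface so that the
complement of the graph is a union of open discs, one of which (the outer face) is distinguished.
`V`, `E`, `F` are the sets of 0-cells, 1-cells and 2-cells of the 2-complex that remains when the
outer face is removed. An oriented edge is a pair `(e, b) : E × Bool`, and `(e, !b)` is the same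
edge with the opposite orientation. -/
structure SurfaceComplex where
  /-- the vertices (0-cells) -/
  V : Type
  /-- the edges (1-cells) -/
  E : Type
  /-- the faces (2-cells), not counting the outer face -/
  F : Type
  finite_V : Finite V
  finite_E : Finite E
  finite_F : Finite F
  /-- the initial vertex of an oriented edge -/
  src : E × Bool → V
  /-- `next d` follows the oriented edge `d` on the boundary of the face on the left of `d` -/
  next : Equiv.Perm (E × Bool)
  /-- the face on the left of an oriented edge; `none` is the outer face -/
  face : E × Bool → Option F
  /-- Passing from `d` to `next (d⁻¹)` is the rotation about the initial vertex of `d`; it permutes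
  the oriented edges that start at this vertex cyclically. -/
  src_eq_iff : ∀ d d' : E × Bool, src d = src d' ↔
    Equiv.Perm.SameCycle (((Equiv.refl E).prodCongr Equiv.boolNot).trans next) d d'
  /-- The oriented edges with a given face on their left form one cycle: the boundary of the face
  is a single closed path. -/
  face_eq_iff : ∀ d d' : E × Bool, face d = face d' ↔ Equiv.Perm.SameCycle next d d'
  /-- every 2-cell has a boundary path of positive length -/
  exists_face_eq : ∀ f : F, ∃ d, face d = some f
  /-- so has the outer face, unless there are no edges at all -/
  exists_outer : E → ∃ d, face d = none

namespace SurfaceComplex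

variable (Δ : SurfaceComplex)

/-- The oriented edge with the opposite orientation. -/
def inv (d : Δ.E × Bool) : Δ.E × Bool := (d.1, !d.2)

/-- The terminal vertex of an oriented edge. -/
def tgt (d : Δ.E × Bool) : Δ.V := Δ.src (Δ.inv d)

/-- `Δ.IsPath u p v`: the sequence `p` of oriented edges is a path from `u` to `v`. -/
def IsPath : Δ.V → List (Δ.E × Bool) → Δ.V → Prop
  | u, [], v => u = v
  | u, d :: p, v => Δ.src d = u ∧ IsPath (Δ.tgt d) p v

/-- The closed path, starting with `d`, once around the boundary of the face on the left
of `d`. -/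
noncomputable def facePath (d : Δ.E × Bool) : List (Δ.E × Bool) :=
  List.iterate Δ.next d (Function.minimalPeriod Δ.next d)

/-- Elementary homotopies of paths from `u` to `v`: insertion of a backtracking `d d⁻¹`, or of the
boundary path of a 2-cell (not of the outer face). -/
inductive HomotopyStep (u v : Δ.V) : List (Δ.E × Bool) → List (Δ.E × Bool) → Prop
  | backtrack (p q : List (Δ.E × Bool)) (d : Δ.E × Bool) :
      Δ.IsPath u (p ++ q) v → Δ.IsPath u (p ++ [d, Δ.inv d] ++ q) v →
      HomotopyStep u v (p ++ q) (p ++ [d, Δ.inv d] ++ q)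
  | cell (p q : List (Δ.E × Bool)) (d : Δ.E × Bool) (f : Δ.F) : Δ.face d = some f →
      Δ.IsPath u (p ++ q) v → Δ.IsPath u (p ++ Δ.facePath d ++ q) v →
      HomotopyStep u v (p ++ q) (p ++ Δ.facePath d ++ q)

/-- The complex is nonempty and path connected. -/
def Connected : Prop := Nonempty Δ.V ∧ ∀ u v : Δ.V, ∃ p, Δ.IsPath u p v

/-- Every closed path is homotopic to the constant path at its base vertex. -/
def SimplyConnected : Prop :=
  ∀ (v : Δ.V) (p : List (Δ.E × Bool)), Δ.IsPath v p v →
    Relation.EqvGen (Δ.HomotopyStep v v) p []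

/-- Euler's formula `|V| - |E| + (|F| + 1) = 2`, where the outer face is counted as well: for a
connected complex it says that the surface is a sphere, so that the complex, being the complement
of the outer face, lies in the plane. -/
def Planar : Prop := Nat.card Δ.V + Nat.card Δ.F = Nat.card Δ.E + 1

end SurfaceComplex

/-- A van Kampen diagram over the presentation with alphabet `A` and relator set `R`: a planar,
finite, connected and simply connected 2-complex with oriented edges labelled by letters of
`A^{±1}`, in such a way that going around any 2-cell one reads, as a cyclic word, a relator or the
inverse of a relator. As in `FreeGroup`, the letter `(a, true)` is `a` and `(a, false)` is `a⁻¹`.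
Exactly one of the two orientations of an edge has a label in `A`; this is the orientation `(e, true)`,
and `letter e` is its label. -/
structure Diagram {A : Type} (R : Set (List (A × Bool))) extends SurfaceComplex where
  connected : toSurfaceComplex.Connected
  simplyConnected : toSurfaceComplex.SimplyConnected
  planar : toSurfaceComplex.Planar
  /-- the label of the oriented edge `(e, true)` -/
  letter : E → A
  relator : ∀ (d : E × Bool) (f : F), face d = some f → ∃ r ∈ R,
    ((toSurfaceComplex.facePath d).map (Prod.map letter id) ~r r ∨
      (toSurfaceComplex.facePath d).map (Prod.map letter id) ~r FreeGroup.invRev r)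

namespace Diagram

variable {A : Type} {R : Set (List (A × Bool))}

/-- The label in `A^{±1}` of an oriented edge. -/
def label (Δ : Diagram R) : Δ.E × Bool → A × Bool := Prod.map Δ.letter id

/-- The number `|Δ(1)|` of edges. -/
noncomputable def numEdges (Δ : Diagram R) : ℕ := Nat.card Δ.E

/-- The boundary of `Δ` (the boundary path of the outer face, which is the constant path if
`Δ` is a single vertex) is labelled by the cyclic word `W`. -/
def HasBoundaryLabel (Δ : Diagram R) (W : List (A × Bool)) : Prop :=
  (IsEmpty Δ.E ∧ W = []) ∨
    ∃ d, Δ.face d = none ∧ (Δ.facePath d).map Δ.label ~r W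

end Diagram

section Presentation

variable {A : Type} (R : Set (List (A × Bool)))

/-- The word `W` represents the identity of the group with generators `A` and relators `R`. -/
def IsConsequence (W : List (A × Bool)) : Prop :=
  FreeGroup.mk W ∈ Subgroup.normalClosure (FreeGroup.mk '' R)

/-- `L₁(W)`: the least number of edges of a van Kampen diagram with boundary label `W`. -/
noncomputable def minEdges (W : List (A × Bool)) : ℕ :=
  sInf {n | ∃ Δ : Diagram R, Δ.HasBoundaryLabel W ∧ Δ.numEdges = n}

/-- The Dehn 1-function `f₁(x)`: the maximum of `L₁(W)` over the consequences `W` of the relators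
of length at most `x`. (There are finitely many such `W` if `A` is finite, and the empty word is
one of them.) -/
noncomputable def dehnOne (x : ℕ) : ℕ :=
  sSup {n | ∃ W : List (A × Bool), IsConsequence R W ∧ W.length ≤ x ∧ minEdges R W = n}

end Presentation

end VanKampen

/-! A word is a consequence of the relators exactly when it bounds a van Kampen diagram. If `R` is
decidable, then for each `N` the words that bound a diagram with at most `N` edges can be listed
effectively, because only relators of length at most `2 * N` can occur in such a diagram. If `f₁` is
computable, a word `W` is therefore tested by looking for it in the list for `N = f₁(|W|)`.
Conversely, a solution of the word problem lists the consequences of length at most `x`, and `f₁(x)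
≤ N` holds iff all of them occur in the list for `N`; so this relation is decidable, and `f₁(x)` is
found as the least such `N`.

The work lies in passing from topological diagrams to something that can be enumerated. The
predicate `Fill R n k W` records how a diagram is taken apart by deleting the first edge of its
boundary: that edge is a bridge between two smaller diagrams, or it has a cell on its other side,
and then the rest of the boundary of this cell becomes part of the outer boundary. Both rules
account for exactly one edge.

Three facts carry the proof. Van Kampen's lemma for `Fill` is `exists_fill_of_area`. The equivalence
of fillings and diagrams with the same number of edges is `exists_diagram_iff`: in one direction
edges are peeled off, and vanishing first cohomology mod 2 shows that an edge with no cell on either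
side separates; in the other, `Fill.exists_isDisc` builds a complex edge by edge. The enumeration is
`exists_computable_fillList`. -/

namespace VanKampen

/-! ### Words, letters and cyclic conjugates of relators -/

section Words

variable {A : Type}

/-- The inverse of a letter of `A^{±1}`; also the opposite orientation of an oriented edge. -/
def flip (x : A × Bool) : A × Bool := (x.1, !x.2)

@[simp] theorem flip_flip (x : A × Bool) : flip (flip x) = x := by simp [flip]

theorem flip_ne (x : A × Bool) : flip x ≠ x := by
  intro h
  simpa [flip] using congrArg Prod.snd h

theorem invRev_eq (W : List (A × Bool)) : FreeGroup.invRev W = (W.map flip).reverse := rfl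

@[simp] theorem invRev_nil : FreeGroup.invRev ([] : List (A × Bool)) = [] := rfl

theorem invRev_cons_flip (x : A × Bool) (W : List (A × Bool)) :
    FreeGroup.invRev (x :: W) = FreeGroup.invRev W ++ [flip x] := by
  simp [invRev_eq]

/-- The element of the free group given by a letter. -/
def gen (x : A × Bool) : FreeGroup A := FreeGroup.mk [x]

@[simp] theorem gen_flip (x : A × Bool) : gen (flip x) = (gen x)⁻¹ := by
  simp [gen, flip, FreeGroup.inv_mk, FreeGroup.invRev]

theorem mk_nil : FreeGroup.mk ([] : List (A × Bool)) = 1 := rfl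

theorem mk_cons (x : A × Bool) (W : List (A × Bool)) :
    FreeGroup.mk (x :: W) = gen x * FreeGroup.mk W := by
  simp [gen]

theorem mk_append (U V : List (A × Bool)) :
    FreeGroup.mk (U ++ V) = FreeGroup.mk U * FreeGroup.mk V := by
  simp

theorem mk_invRev (U : List (A × Bool)) :
    FreeGroup.mk (FreeGroup.invRev U) = (FreeGroup.mk U)⁻¹ := FreeGroup.inv_mk.symm

/-- The marked letter `y` falls on one side of the cut or on the other. This is how the partner of a
bridge is located in a boundary word. -/
theorem append_cons_eq_append {α : Type*} {U V P Q : List α} {y : α} (h : U ++ y :: V = P ++ Q) :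
    (∃ a, P = U ++ y :: a ∧ V = a ++ Q) ∨ ∃ b, U = P ++ b ∧ Q = b ++ y :: V := by
  rcases List.append_eq_append_iff.1 h with ⟨a, h1, h2⟩ | ⟨b, h1, h2⟩
  · cases a with
    | nil => exact Or.inr ⟨[], by simpa using h1.symm, by simpa using h2.symm⟩
    | cons z a =>
      obtain ⟨rfl, rfl⟩ : y = z ∧ V = a ++ Q := by simpa using h2
      exact Or.inl ⟨a, h1, rfl⟩
  · exact Or.inr ⟨b, h1, h2⟩

/-- The cyclic conjugates of the words in `R` and of their inverses. -/
def cyclicRelators (R : Set (List (A × Bool))) : Set (List (A × Bool)) :=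
  {w | ∃ r ∈ R, w ~r r ∨ w ~r FreeGroup.invRev r}

variable {R : Set (List (A × Bool))}

theorem cyclicRelators_of_isRotated {u v : List (A × Bool)} (h : u ∈ cyclicRelators R)
    (huv : u ~r v) : v ∈ cyclicRelators R := by
  obtain ⟨r, hr, h | h⟩ := h
  · exact ⟨r, hr, Or.inl (huv.symm.trans h)⟩
  · exact ⟨r, hr, Or.inr (huv.symm.trans h)⟩

theorem cyclicRelators_rotate {u v : List (A × Bool)} (h : u ++ v ∈ cyclicRelators R) :
    v ++ u ∈ cyclicRelators R :=
  cyclicRelators_of_isRotated h List.isRotated_append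

theorem isRotated_invRev {u v : List (A × Bool)} (h : u ~r v) :
    FreeGroup.invRev u ~r FreeGroup.invRev v :=
  (h.map _).reverse

theorem cyclicRelators_invRev {u : List (A × Bool)} (h : u ∈ cyclicRelators R) :
    FreeGroup.invRev u ∈ cyclicRelators R := by
  obtain ⟨r, hr, h | h⟩ := h
  · exact ⟨r, hr, Or.inr (isRotated_invRev h)⟩
  · exact ⟨r, hr, Or.inl (by simpa using isRotated_invRev h)⟩

/-! ### Fillings: diagrams described by deleting boundary edges -/

/-- `Fill R n k W`: the word `W` is the boundary label of a planar diagram with `n` edges and `k`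
cells. The rules say how the diagram arises from what remains after the deletion of the first edge
of its boundary path. -/
inductive Fill (R : Set (List (A × Bool))) : ℕ → ℕ → List (A × Bool) → Prop
  | nil : Fill R 0 0 []
  | bridge {n k n' k' : ℕ} (x : A × Bool) (U V : List (A × Bool)) :
      Fill R n k U → Fill R n' k' V → Fill R (n + n' + 1) (k + k') (x :: (U ++ flip x :: V))
  | cell {n k : ℕ} (x : A × Bool) (S W : List (A × Bool)) :
      flip x :: S ∈ cyclicRelators R → Fill R n k (S ++ W) → Fill R (n + 1) (k + 1) (x :: W)

namespace Fill

theorem cast {n k n' k' : ℕ} {W W' : List (A × Bool)} (h : Fill R n k W) (hn : n = n')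
    (hk : k = k') (hW : W = W') : Fill R n' k' W' := by
  subst hn hk hW
  exact h

theorem append {n k n' k' : ℕ} {U V : List (A × Bool)} (hU : Fill R n k U)
    (hV : Fill R n' k' V) : Fill R (n + n') (k + k') (U ++ V) := by
  induction hU with
  | nil => exact hV.cast (by omega) (by omega) rfl
  | bridge x U Z h1 h2 _ ih => exact (bridge x U _ h1 ih).cast (by omega) (by omega) (by simp)
  | cell x S W hr _ ih =>
    exact (cell x S (W ++ V) hr (ih.cast rfl rfl (by simp))).cast (by omega) (by omega) rfl

/-- A diagram can be hung at any boundary vertex: the point of insertion is followed through the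
peeling of the filling until it reaches the front of a word. -/
theorem insert {n k n' k' : ℕ} {U W₁ W₂ : List (A × Bool)} (h : Fill R n k (W₁ ++ W₂))
    (hU : Fill R n' k' U) : Fill R (n + n') (k + k') (W₁ ++ (U ++ W₂)) := by
  generalize hW : W₁ ++ W₂ = W at h
  induction h generalizing W₁ W₂ with
  | nil =>
    obtain ⟨rfl, rfl⟩ := List.append_eq_nil_iff.1 hW
    exact hU.cast (by omega) (by omega) (by simp)
  | @bridge n₁ k₁ n₂ k₂ x P Q h1 h2 ih1 ih2 =>
    cases W₁ with
    | nil =>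
      subst hW
      exact (hU.append (bridge x P Q h1 h2)).cast (by omega) (by omega) rfl
    | cons y W₁ =>
      obtain ⟨rfl, hW⟩ : y = x ∧ W₁ ++ W₂ = P ++ flip x :: Q := by simpa using hW
      rcases append_cons_eq_append hW.symm with ⟨a, rfl, rfl⟩ | ⟨b, rfl, rfl⟩
      · exact (bridge y P _ h1 (ih2 rfl)).cast (by omega) (by omega) (by simp)
      · exact (bridge y _ Q (ih1 rfl) h2).cast (by omega) (by omega) (by simp)
  | @cell n₁ k₁ x S W hr h ih =>
    cases W₁ with
    | nil =>
      subst hW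
      exact (hU.append (cell x S W hr h)).cast (by omega) (by omega) rfl
    | cons y W₁ =>
      obtain ⟨rfl, rfl⟩ : y = x ∧ W₁ ++ W₂ = W := by simpa using hW
      have := ih (W₁ := S ++ W₁) (W₂ := W₂) (by simp)
      exact (cell y S _ hr (this.cast rfl rfl (by simp))).cast (by omega) (by omega) rfl

/-- The rules of `Fill` privilege the first boundary edge; the base point is irrelevant, and a cell
may be attached along any segment. The two facts need each other: moving the first letter past a
cell attaches this cell at the end of a rotated smaller diagram, and attaching in the middle rotates
smaller diagrams. Hence a single induction on the number of edges. -/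
theorem rotate_and_cell (n : ℕ) :
    (∀ k (U V : List (A × Bool)), Fill R n k (U ++ V) → Fill R n k (V ++ U)) ∧
    ∀ k (x : A × Bool) (S W₁ W₂ : List (A × Bool)), flip x :: S ∈ cyclicRelators R →
      Fill R n k (W₁ ++ (S ++ W₂)) → Fill R (n + 1) (k + 1) (W₁ ++ x :: W₂) := by
  induction n using Nat.strong_induction_on with
  | _ n ih =>
    have hrot : ∀ k (x : A × Bool) (W : List (A × Bool)),
        Fill R n k (x :: W) → Fill R n k (W ++ [x]) := by
      intro k x W h
      cases h with
      | @bridge n₁ k₁ n₂ k₂ _ U V h1 h2 =>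
        exact (h1.append (bridge (flip x) V [] h2 nil)).cast (by omega) (by omega) (by simp)
      | @cell n₁ k₁ _ S _ hr h =>
        have h := (ih n₁ (by omega)).1 _ _ _ h
        exact (ih n₁ (by omega)).2 _ x S W [] hr (by simpa using h)
    refine ⟨fun k U V => ?_, fun k x S W₁ W₂ hr h => ?_⟩
    · induction U generalizing V with
      | nil => simp
      | cons x U ihU =>
        intro h
        have := ihU (V ++ [x]) ((hrot k x (U ++ V) h).cast rfl rfl (by simp))
        exact this.cast rfl rfl (by simp)
    · cases W₁ with
      | nil => exact cell x S W₂ hr h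
      | cons y W₁ =>
        generalize hW : y :: W₁ ++ (S ++ W₂) = W at h
        cases h with
        | nil => simp at hW
        | @bridge n₁ k₁ n₂ k₂ z U V h1 h2 =>
          obtain ⟨rfl, hW⟩ : y = z ∧ W₁ ++ (S ++ W₂) = U ++ flip z :: V := by simpa using hW
          rcases append_cons_eq_append hW.symm with ⟨a, rfl, rfl⟩ | ⟨b, rfl, hb⟩
          · have := (ih n₂ (by omega)).2 _ x S a W₂ hr h2
            exact (bridge y _ _ h1 this).cast (by omega) (by omega) (by simp)
          · rcases append_cons_eq_append hb.symm with ⟨a, rfl, rfl⟩ | ⟨c, rfl, rfl⟩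
            -- Here the partner of `y` lies on the segment covered by the new cell, so `y` now
            -- borders this cell, whose boundary is `y⁻¹ a x⁻¹ b`. Once `y` is deleted, `x` is a
            -- bridge that carries `b W₁`.
            · have h1 := (ih n₁ (by omega)).1 _ _ _ h1
              have h3 := bridge (flip x) (b ++ W₁) [] h1 nil
              have h4 : Fill R (n₁ + n₂ + 1) (k₁ + k₂) (a ++ flip x :: (b ++ W₁ ++ x :: W₂)) :=
                (insert (W₁ := a) (W₂ := W₂) h2 h3).cast (by omega) (by omega) (by simp)
              have hr' : flip y :: (a ++ flip x :: b) ∈ cyclicRelators R := by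
                have := cyclicRelators_rotate (u := flip x :: b) (v := flip y :: a)
                  (by simpa using hr)
                simpa using this
              exact cell y (a ++ flip x :: b) (W₁ ++ x :: W₂) hr'
                (h4.cast rfl rfl (by simp))
            · have := (ih n₁ (by omega)).2 _ x S W₁ c hr h1
              exact (bridge y _ _ this h2).cast (by omega) (by omega) (by simp)
        | @cell n₁ k₁ z T W' hr' h' =>
          obtain ⟨rfl, rfl⟩ : y = z ∧ W₁ ++ (S ++ W₂) = W' := by simpa using hW
          have := (ih n₁ (by omega)).2 _ x S (T ++ W₁) W₂ hr (h'.cast rfl rfl (by simp))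
          exact cell y T _ hr' (this.cast rfl rfl (by simp))

theorem rotate {n k : ℕ} {U V : List (A × Bool)} (h : Fill R n k (U ++ V)) :
    Fill R n k (V ++ U) :=
  (rotate_and_cell n).1 k U V h

theorem of_isRotated {n k : ℕ} {U V : List (A × Bool)} (h : Fill R n k U) (hUV : U ~r V) :
    Fill R n k V := by
  obtain ⟨i, hi, rfl⟩ := List.isRotated_iff_mod.1 hUV
  rw [List.rotate_eq_drop_append_take hi]
  exact rotate (by simpa using h)

/-- An edge has two sides, so it occurs at most twice on the boundary. This bounds the length of the
relators that a diagram with `n` edges can use. -/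
theorem length_le {n k : ℕ} {W : List (A × Bool)} (h : Fill R n k W) : W.length ≤ 2 * n := by
  induction h with
  | nil => simp
  | bridge => simp only [List.length_cons, List.length_append]; omega
  | cell => simp only [List.length_cons, List.length_append] at *; omega

end Fill

/-! ### Products of conjugates of relators -/

/-- `Area R k g`: the element `g` of the free group is a product of at most `k` conjugates of
relators and their inverses. -/
inductive Area (R : Set (List (A × Bool))) : ℕ → FreeGroup A → Prop
  | one : Area R 0 1
  | succ {k : ℕ} {g : FreeGroup A} : Area R k g → Area R (k + 1) g
  | mul {k : ℕ} {g : FreeGroup A} (h : FreeGroup A) (r : List (A × Bool)) :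
      r ∈ cyclicRelators R → Area R k g → Area R (k + 1) (h * FreeGroup.mk r * h⁻¹ * g)

namespace Area

theorem cast {k k' : ℕ} {g g' : FreeGroup A} (h : Area R k g) (hk : k = k') (hg : g = g') :
    Area R k' g' := by
  subst hk hg
  exact h

theorem mono {k k' : ℕ} {g : FreeGroup A} (h : Area R k g) (hk : k ≤ k') : Area R k' g := by
  induction hk with
  | refl => exact h
  | step _ ih => exact ih.succ

theorem mul_area {k k' : ℕ} {g g' : FreeGroup A} (h : Area R k g) (h' : Area R k' g') :
    Area R (k + k') (g * g') := by
  induction h with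
  | one => exact h'.cast (by omega) (by simp)
  | succ _ ih => exact ih.succ.cast (by omega) rfl
  | mul u r hr _ ih => exact (mul u r hr ih).cast (by omega) (by group)

theorem conj {k : ℕ} {g : FreeGroup A} (h : Area R k g) (u : FreeGroup A) :
    Area R k (u * g * u⁻¹) := by
  induction h with
  | one => exact one.cast rfl (by simp)
  | succ _ ih => exact ih.succ
  | mul v r hr _ ih => exact (mul (u * v) r hr ih).cast rfl (by group)

theorem of_mem (u : FreeGroup A) {r : List (A × Bool)} (hr : r ∈ cyclicRelators R) :
    Area R 1 (u * FreeGroup.mk r * u⁻¹) :=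
  (mul u r hr one).cast rfl (by simp)

theorem inv {k : ℕ} {g : FreeGroup A} (h : Area R k g) : Area R k g⁻¹ := by
  induction h with
  | one => exact one.cast rfl (by simp)
  | succ _ ih => exact ih.succ
  | mul v r hr _ ih =>
    refine (ih.mul_area (of_mem v (cyclicRelators_invRev hr))).cast rfl ?_
    rw [mk_invRev]
    group

theorem eq_one_of_zero {g : FreeGroup A} (h : Area R 0 g) : g = 1 := by
  cases h
  rfl

end Area

theorem mk_mem_normalClosure {r : List (A × Bool)} (hr : r ∈ cyclicRelators R) :
    FreeGroup.mk r ∈ Subgroup.normalClosure (FreeGroup.mk '' R) := by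
  have key : ∀ u v : List (A × Bool),
      FreeGroup.mk v ∈ Subgroup.normalClosure (FreeGroup.mk '' R) → u ~r v →
      FreeGroup.mk u ∈ Subgroup.normalClosure (FreeGroup.mk '' R) := by
    intro u v hv huv
    obtain ⟨i, hi, rfl⟩ := List.isRotated_iff_mod.1 huv.symm
    -- Moving the first `i` letters to the end is conjugation by `v.drop i`.
    have h1 : FreeGroup.mk (v.drop i) * FreeGroup.mk v * (FreeGroup.mk (v.drop i))⁻¹ =
        FreeGroup.mk (v.rotate i) := by
      rw [List.rotate_eq_drop_append_take hi]
      conv_lhs => rw [← List.take_append_drop i v]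
      simp only [mk_append]
      rw [List.take_append_drop, ← mk_append, ← mk_append, mul_inv_eq_iff_eq_mul, ← mk_append]
      simp
    rw [← h1]
    exact Subgroup.normalClosure_normal.conj_mem _ hv _
  obtain ⟨s, hs, h | h⟩ := hr
  · exact key _ _ (Subgroup.subset_normalClosure ⟨s, hs, rfl⟩) h
  · refine key _ _ ?_ h
    rw [mk_invRev]
    exact inv_mem (Subgroup.subset_normalClosure ⟨s, hs, rfl⟩)

theorem isConsequence_iff_area {W : List (A × Bool)} :
    IsConsequence R W ↔ ∃ k, Area R k (FreeGroup.mk W) := by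
  constructor
  · intro h
    refine Subgroup.closure_induction (p := fun g _ => ∃ k, Area R k g) ?_ ⟨0, Area.one⟩ ?_ ?_ h
    · intro g hg
      obtain ⟨_, ⟨r, hr, rfl⟩, hg⟩ := Group.mem_conjugatesOfSet_iff.1 hg
      obtain ⟨c, rfl⟩ := isConj_iff.1 hg
      exact ⟨1, Area.of_mem c ⟨r, hr, Or.inl (List.IsRotated.refl r)⟩⟩
    · rintro g g' _ _ ⟨k, hk⟩ ⟨k', hk'⟩
      exact ⟨_, hk.mul_area hk'⟩
    · rintro g _ ⟨k, hk⟩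
      exact ⟨k, hk.inv⟩
  · rintro ⟨k, h⟩
    unfold IsConsequence
    generalize FreeGroup.mk W = g at h
    induction h with
    | one => exact one_mem _
    | succ _ ih => exact ih
    | mul u r hr _ ih =>
      exact mul_mem (Subgroup.normalClosure_normal.conj_mem _ (mk_mem_normalClosure hr) _) ih

/-- The easy half of van Kampen's lemma: at a bridge the boundary element is a conjugate of one
factor times the other, and deleting an edge of a cell splits off one conjugate of a relator. -/
theorem Fill.area {n k : ℕ} {W : List (A × Bool)} (h : Fill R n k W) :
    Area R k (FreeGroup.mk W) := by
  induction h with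
  | nil => exact Area.one
  | bridge x U V _ _ ih1 ih2 =>
    refine ((ih1.conj (gen x)).mul_area ih2).cast rfl ?_
    simp only [mk_cons, mk_append, gen_flip]
    group
  | cell x S W hr _ ih =>
    refine (Area.mul (gen x) _ (cyclicRelators_invRev hr) (ih.conj 1)).cast rfl ?_
    rw [mk_invRev]
    simp only [mk_cons, mk_append, gen_flip]
    group

/-- Undoing the free cancellations one at a time hangs a single edge on the diagram each time, so a
tree results. -/
theorem exists_fill_of_mk_eq_one {W : List (A × Bool)} (h : FreeGroup.mk W = 1) :
    ∃ n, Fill R n 0 W := by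
  have hred : FreeGroup.Red W [] := by
    obtain ⟨c, h1, h2⟩ := FreeGroup.Red.exact.1 (h.trans mk_nil.symm)
    rwa [FreeGroup.Red.nil_iff.1 h2] at h1
  induction hred using Relation.ReflTransGen.head_induction_on with
  | refl => exact ⟨0, Fill.nil⟩
  | head hs _ ih =>
    have hs' := FreeGroup.Red.Step.to_red hs
    obtain ⟨n, hn⟩ := ih ((FreeGroup.Red.exact.2 ⟨_, hs', FreeGroup.Red.refl⟩).symm.trans h)
    cases hs with
    | @not L₁ L₂ x b =>
      exact ⟨_, (Fill.insert hn (Fill.bridge (x, b) [] [] Fill.nil Fill.nil)).cast rfl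
        (by omega) (by simp [flip])⟩

/-! ### Van Kampen's lemma -/

/-- Van Kampen's lemma: every product of at most `k` conjugates of relators bounds a diagram. -/
theorem exists_fill_of_area (k : ℕ) : ∀ W : List (A × Bool), Area R k (FreeGroup.mk W) →
    ∃ n, ∃ j ≤ k, Fill R n j W := by
  induction k using Nat.strong_induction_on with
  | _ k ih =>
    cases k with
    | zero =>
      intro W h
      obtain ⟨n, hn⟩ := exists_fill_of_mk_eq_one (R := R) h.eq_one_of_zero
      exact ⟨n, 0, le_rfl, hn⟩
    | succ k =>
      -- One factor is moved to the other side: `W` followed by the lollipop `h r h⁻¹` has area `k`,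
      -- hence a filling by the outer induction. The role of the first edge `z` of `W` in it
      -- decides. If `z` lies on a cell, or is paired with an edge of `r`, a cell at `z` can be
      -- removed; otherwise `z` is a bridge that splits `W` or allows the stem `h` to be shortened.
      -- This replaces the folding of edges and the discarding of spheres, and it never increases
      -- the number of cells.
      have main : ∀ (l : ℕ) (W h r : List (A × Bool)), r ∈ cyclicRelators R →
          W.length + h.length ≤ l →
          Area R k (FreeGroup.mk (W ++ (h ++ (r ++ FreeGroup.invRev h)))) →
          ∃ n, ∃ j ≤ k + 1, Fill R n j W := by
        intro l
        induction l with
        | zero =>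
          intro W h r _ hl _
          have : W = [] := List.eq_nil_of_length_eq_zero (by omega)
          subst this
          exact ⟨0, 0, by omega, Fill.nil⟩
        | succ l ihl =>
          intro W h r hr hl hA
          cases W with
          | nil => exact ⟨0, 0, by omega, Fill.nil⟩
          | cons z W =>
            obtain ⟨n, j, hj, hF⟩ := ih k (by omega) _ hA
            have hrelator : ∀ u : FreeGroup A, Area R 1 (u * (FreeGroup.mk r)⁻¹ * u⁻¹) := by
              intro u
              rw [← mk_invRev]
              exact Area.of_mem u (cyclicRelators_invRev hr)
            have hcell : ∀ S : List (A × Bool), flip z :: S ∈ cyclicRelators R →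
                Area R k (FreeGroup.mk (S ++ W)) →
                ∃ n, ∃ j ≤ k + 1, Fill R n j (z :: W) := by
              intro S hS hA
              obtain ⟨n, j, hj, hF⟩ := ih k (by omega) _ hA
              exact ⟨n + 1, j + 1, by omega, Fill.cell z S W hS hF⟩
            generalize hX : z :: W ++ (h ++ (r ++ FreeGroup.invRev h)) = X at hF
            cases hF with
            | nil => simp at hX
            -- Deleting the cell at `z` lowers the area by one and cancelling the lollipop raises it
            -- by one, so `S W` has area at most `k`.
            | @cell n₁ k₁ y S Y hS hF =>
              obtain ⟨rfl, rfl⟩ : z = y ∧ W ++ (h ++ (r ++ FreeGroup.invRev h)) = Y := by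
                simpa using hX
              refine hcell S hS (((hF.area.mul_area (hrelator (FreeGroup.mk h))).mono hj).cast
                rfl ?_)
              simp only [mk_append, mk_invRev]
              group
            | @bridge n₁ k₁ n₂ k₂ y U V hU hV =>
              obtain ⟨rfl, hX⟩ : z = y ∧ W ++ (h ++ (r ++ FreeGroup.invRev h)) =
                U ++ flip y :: V := by simpa using hX
              have aU := hU.area
              have aV := hV.area
              rcases append_cons_eq_append hX.symm with ⟨W', rfl, rfl⟩ | ⟨b, rfl, hX1⟩
              · -- the edge paired with the first one lies on `W` itself
                have aW : Area R (k₂ + 1) (FreeGroup.mk W') := by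
                  refine (aV.mul_area (hrelator (FreeGroup.mk h))).cast rfl ?_
                  simp only [mk_append, mk_invRev]
                  group
                have : ∃ n, ∃ j ≤ k₂ + 1, Fill R n j W' := by
                  -- When `k₂ = k` the outer induction is not available, but then `k₁ = 0` and the
                  -- inner one applies, since `W'` is shorter.
                  rcases lt_or_ge (k₂ + 1) (k + 1) with hlt | hge
                  · exact ih _ hlt _ aW
                  · obtain ⟨n, j, hj', hF⟩ := ihl W' h r hr
                      (by simp only [List.length_cons, List.length_append] at hl; omega)
                      (aV.mono (by omega))
                    exact ⟨n, j, by omega, hF⟩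
                obtain ⟨n, j, hj', hF⟩ := this
                exact ⟨_, _, by omega, Fill.bridge z U W' hU hF⟩
              rcases append_cons_eq_append hX1.symm with ⟨h', rfl, rfl⟩ | ⟨b, rfl, hX2⟩
              -- The partner lies on the stem `h = b z⁻¹ h'`. The two pieces, suitably conjugated,
              -- multiply to the same word with the shorter stem `h'`.
              · refine ihl (z :: W) h' r hr
                  (by simp only [List.length_cons, List.length_append] at hl ⊢; omega) ?_
                refine (((aU.conj (gen z)).mul_area
                  (aV.conj (gen z * (FreeGroup.mk b)⁻¹))).mono hj).cast rfl ?_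
                simp only [mk_cons, mk_append, mk_invRev, gen_flip]
                group
              rcases append_cons_eq_append hX2.symm with ⟨r', rfl, rfl⟩ | ⟨b, rfl, hX3⟩
              -- The partner lies on `r = b z⁻¹ r'`, so `z` borders the cell that is to be glued in,
              -- and `r' b` is the rest of its boundary.
              · refine hcell (r' ++ b) ?_ ?_
                · simpa using cyclicRelators_rotate (v := flip z :: r') hr
                · refine ((aV.mul_area (aU.conj (FreeGroup.mk W)⁻¹)).mono (by omega)).cast rfl ?_
                  simp only [mk_append, mk_invRev]
                  group
              · -- the partner lies on the way back from the relator
                have hh : h = FreeGroup.invRev V ++ z :: FreeGroup.invRev b := by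
                  rw [← FreeGroup.invRev_invRev (L₁ := h), hX3]
                  simp [FreeGroup.invRev_append, invRev_cons_flip]
                -- If `V` is nonempty, the initial segment `V⁻¹` of the stem is dropped. If it is
                -- empty, the stem begins with `z`, and rotating `z` to the end of `W` absorbs this
                -- letter.
                rcases eq_or_ne V [] with rfl | hV0
                · have hh : h = z :: FreeGroup.invRev b := by simpa using hh
                  obtain ⟨n, j, hj', hF⟩ := ihl (W ++ [z]) (FreeGroup.invRev b) r hr
                    (by rw [hh] at hl; simp only [List.length_cons, List.length_append,
                          List.length_nil] at hl ⊢; omega)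
                    ((aU.mono (by omega)).cast rfl (by simp [hh]))
                  exact ⟨n, j, hj', hF.rotate⟩
                · have : 0 < V.length := List.length_pos_iff.2 hV0
                  refine ihl (z :: W) (z :: FreeGroup.invRev b) r hr
                    (by rw [hh] at hl; simp only [List.length_cons, List.length_append,
                          FreeGroup.invRev_length] at hl ⊢; omega) ?_
                  refine (((aV.conj (FreeGroup.mk (z :: W))).mul_area
                    (aU.conj (gen z))).mono (by omega)).cast rfl ?_
                  rw [hh]
                  simp only [mk_cons, mk_append, mk_invRev]
                  group
      intro W hA
      generalize hg : FreeGroup.mk W = g at hA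
      cases hA with
      | succ hA =>
        subst hg
        obtain ⟨n, j, hj, hF⟩ := ih k (by omega) _ hA
        exact ⟨n, j, by omega, hF⟩
      | @mul _ g u r hr hA =>
        obtain ⟨h, rfl⟩ := Quot.exists_rep u
        refine main _ W h (FreeGroup.invRev r) (cyclicRelators_invRev hr) le_rfl ?_
        change FreeGroup.mk W = FreeGroup.mk h * FreeGroup.mk r * (FreeGroup.mk h)⁻¹ * g at hg
        refine (hA.conj (FreeGroup.mk h * FreeGroup.mk r * (FreeGroup.mk h)⁻¹)).cast rfl ?_
        simp only [mk_append, mk_invRev, hg]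
        group

theorem isConsequence_iff_exists_fill {W : List (A × Bool)} :
    IsConsequence R W ↔ ∃ n k, Fill R n k W := by
  rw [isConsequence_iff_area]
  constructor
  · rintro ⟨k, h⟩
    obtain ⟨n, j, -, hF⟩ := exists_fill_of_area k W h
    exact ⟨n, j, hF⟩
  · rintro ⟨n, k, h⟩
    exact ⟨k, h.area⟩

end Words


/-! ### Surface complexes: face paths and cohomology mod 2 -/

theorem eq_or_eq_flip {α : Type} {a d : α × Bool} (h : a.1 = d.1) : a = d ∨ a = flip d := by
  obtain ⟨a, b⟩ := a
  obtain ⟨d, b'⟩ := d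
  obtain rfl : a = d := h
  cases b <;> cases b' <;> simp [flip]

namespace SurfaceComplex

variable (Δ : SurfaceComplex)

theorem isPath_append {u v : Δ.V} {p q : List (Δ.E × Bool)} :
    Δ.IsPath u (p ++ q) v ↔ ∃ w, Δ.IsPath u p w ∧ Δ.IsPath w q v := by
  induction p generalizing u with
  | nil => simp [IsPath]
  | cons d p ih => simp [IsPath, ih, and_assoc]

theorem tgt_flip (d : Δ.E × Bool) : Δ.tgt (flip d) = Δ.src d := by
  simp [tgt, inv, flip]

theorem isPath_invRev {u v : Δ.V} {p : List (Δ.E × Bool)} (h : Δ.IsPath u p v) :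
    Δ.IsPath v (FreeGroup.invRev p) u := by
  induction p generalizing u with
  | nil => exact (show u = v from h).symm
  | cons d p ih =>
    rw [invRev_cons_flip]
    exact (Δ.isPath_append).2 ⟨_, ih h.2, rfl, (Δ.tgt_flip d).trans h.1⟩

theorem src_next (d : Δ.E × Bool) : Δ.src (Δ.next d) = Δ.tgt d := by
  refine ((Δ.src_eq_iff (Δ.inv d) (Δ.next d)).2 ?_).symm
  exact ⟨1, by simp [inv, Equiv.prodCongr]⟩

theorem isPath_iterate (d : Δ.E × Bool) (n : ℕ) :
    Δ.IsPath (Δ.src d) (List.iterate Δ.next d n) (Δ.src (Δ.next^[n] d)) := by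
  induction n generalizing d with
  | zero => rfl
  | succ n ih =>
    refine ⟨rfl, ?_⟩
    rw [← Δ.src_next]
    exact ih (Δ.next d)

theorem mem_periodicPts (d : Δ.E × Bool) : d ∈ Function.periodicPts Δ.next := by
  have := Δ.finite_E
  exact Function.Injective.mem_periodicPts Δ.next.injective d

theorem isPath_facePath (d : Δ.E × Bool) : Δ.IsPath (Δ.src d) (Δ.facePath d) (Δ.src d) := by
  have := Δ.isPath_iterate d (Function.minimalPeriod Δ.next d)
  rwa [Function.iterate_minimalPeriod] at this

theorem facePath_eq_cons (d : Δ.E × Bool) : ∃ S, Δ.facePath d = d :: S := by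
  obtain ⟨n, hn⟩ := Nat.exists_eq_succ_of_ne_zero
    (Function.minimalPeriod_pos_of_mem_periodicPts (Δ.mem_periodicPts d)).ne'
  exact ⟨_, by rw [facePath, hn]; rfl⟩

theorem facePath_cycle (d : Δ.E × Bool) :
    (Δ.facePath d : Cycle (Δ.E × Bool)) = Function.periodicOrbit Δ.next d := by
  rw [facePath, Function.periodicOrbit, ← List.range_map_iterate]

theorem nodup_facePath (d : Δ.E × Bool) : (Δ.facePath d).Nodup := by
  rw [← Cycle.nodup_coe_iff, facePath_cycle]
  exact Function.nodup_periodicOrbit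

theorem mem_facePath {d d' : Δ.E × Bool} : d' ∈ Δ.facePath d ↔ Δ.face d' = Δ.face d := by
  have := Δ.finite_E
  rw [← Cycle.mem_coe_iff, facePath_cycle,
    Function.mem_periodicOrbit_iff (Δ.mem_periodicPts d), eq_comm, Δ.face_eq_iff]
  constructor
  · rintro ⟨n, hn⟩
    exact ⟨n, by simpa [Equiv.Perm.iterate_eq_pow] using hn⟩
  · intro h
    obtain ⟨n, hn⟩ := h.exists_nat_pow_eq
    exact ⟨n, by simpa [Equiv.Perm.iterate_eq_pow] using hn⟩

theorem facePath_isRotated {d d' : Δ.E × Bool} (h : Δ.face d' = Δ.face d) :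
    Δ.facePath d' ~r Δ.facePath d := by
  rw [← mem_facePath, ← Cycle.mem_coe_iff, facePath_cycle,
    Function.mem_periodicOrbit_iff (Δ.mem_periodicPts d)] at h
  obtain ⟨n, rfl⟩ := h
  rw [← Cycle.coe_eq_coe, facePath_cycle, facePath_cycle,
    Function.periodicOrbit_apply_iterate_eq (Δ.mem_periodicPts d)]

/-- The sum of a function on the edges along a path. -/
def pathSum (c : Δ.E → ZMod 2) (p : List (Δ.E × Bool)) : ZMod 2 := (p.map fun d => c d.1).sum

theorem pathSum_cons (c : Δ.E → ZMod 2) (d : Δ.E × Bool) (p : List (Δ.E × Bool)) :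
    Δ.pathSum c (d :: p) = c d.1 + Δ.pathSum c p := by
  simp [pathSum]

theorem pathSum_append (c : Δ.E → ZMod 2) (p q : List (Δ.E × Bool)) :
    Δ.pathSum c (p ++ q) = Δ.pathSum c p + Δ.pathSum c q := by
  simp [pathSum]

theorem pathSum_invRev (c : Δ.E → ZMod 2) (p : List (Δ.E × Bool)) :
    Δ.pathSum c (FreeGroup.invRev p) = Δ.pathSum c p := by
  simp [pathSum, FreeGroup.invRev, Function.comp_def]

theorem pathSum_congr {c c' : Δ.E → ZMod 2} {p : List (Δ.E × Bool)}
    (h : ∀ d ∈ p, c d.1 = c' d.1) : Δ.pathSum c p = Δ.pathSum c' p := by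
  unfold pathSum
  rw [List.map_congr_left h]

theorem pathSum_perm (c : Δ.E → ZMod 2) {p q : List (Δ.E × Bool)} (h : p.Perm q) :
    Δ.pathSum c p = Δ.pathSum c q :=
  (h.map _).sum_eq

/-- In a connected and simply connected complex, a `ZMod 2`-valued cocycle is a coboundary. -/
theorem exists_potential (hc : Δ.Connected) (hs : Δ.SimplyConnected) (c : Δ.E → ZMod 2)
    (h : ∀ d f, Δ.face d = some f → Δ.pathSum c (Δ.facePath d) = 0) :
    ∃ g : Δ.V → ZMod 2, ∀ e, c e = g (Δ.src (e, true)) + g (Δ.src (e, false)) := by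
  have hstep : ∀ u v p q, Δ.HomotopyStep u v p q → Δ.pathSum c p = Δ.pathSum c q := by
    rintro u v _ _ (⟨p, q, d, -, -⟩ | ⟨p, q, d, f, hf, -, -⟩)
    · have : Δ.pathSum c [d, Δ.inv d] = 0 := by
        simp [pathSum, inv, CharTwo.add_self_eq_zero]
      simp only [pathSum_append, this, add_zero]
    · simp [pathSum_append, h d f hf]
  have hclosed : ∀ v p, Δ.IsPath v p v → Δ.pathSum c p = 0 := by
    intro v p hp
    have : ∀ p q, Relation.EqvGen (Δ.HomotopyStep v v) p q → Δ.pathSum c p = Δ.pathSum c q := by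
      intro p q hpq
      induction hpq with
      | rel _ _ h => exact hstep _ _ _ _ h
      | refl => rfl
      | symm _ _ _ ih => exact ih.symm
      | trans _ _ _ _ _ ih1 ih2 => exact ih1.trans ih2
    simpa [pathSum] using this _ _ (hs v p hp)
  obtain ⟨⟨v₀⟩, hc⟩ := hc
  choose q hq using hc v₀
  refine ⟨fun v => Δ.pathSum c (q v), fun e => ?_⟩
  have h1 : Δ.IsPath v₀ (q (Δ.src (e, true)) ++
      ([(e, true)] ++ FreeGroup.invRev (q (Δ.src (e, false))))) v₀ :=
    (Δ.isPath_append).2 ⟨_, hq _, (Δ.isPath_append).2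
      ⟨Δ.src (e, false), ⟨rfl, rfl⟩, Δ.isPath_invRev (hq _)⟩⟩
  have h2 := hclosed _ _ h1
  rw [pathSum_append, pathSum_append, pathSum_invRev] at h2
  have h3 : Δ.pathSum c [(e, true)] = c e := by simp [pathSum]
  rw [h3] at h2
  clear h3 h1
  change c e = Δ.pathSum c (q (Δ.src (e, true))) + Δ.pathSum c (q (Δ.src (e, false)))
  generalize Δ.pathSum c (q (Δ.src (e, true))) = a at *
  generalize Δ.pathSum c (q (Δ.src (e, false))) = b at *
  generalize c e = x at *
  revert a b x
  decide

/-! ### Parts of a complex that remain after deleting boundary edges -/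

/-- A part of a complex, consisting of the edges in `A` and the faces in `Φ`, that is bounded by
the closed path `p`, has vanishing first cohomology and has no closed component away from `p`. -/
structure IsPart (A : Set Δ.E) (Φ : Set Δ.F) (p : List (Δ.E × Bool)) : Prop where
  nodup : p.Nodup
  closed : ∃ u, Δ.IsPath u p u
  mem_edges : ∀ d ∈ p, d.1 ∈ A
  face_edges : ∀ d, ∀ f ∈ Φ, Δ.face d = some f → d.1 ∈ A
  mem_iff : ∀ d, d.1 ∈ A → (d ∈ p ↔ ¬ ∃ f ∈ Φ, Δ.face d = some f)
  potential : ∀ c : Δ.E → ZMod 2,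
    (∀ d, ∀ f ∈ Φ, Δ.face d = some f → Δ.pathSum c (Δ.facePath d) = 0) →
    ∃ g : Δ.V → ZMod 2, ∀ e ∈ A, c e = g (Δ.src (e, true)) + g (Δ.src (e, false))
  meets : ∀ X : Set Δ.E, X ⊆ A →
    (∀ d d', ∀ f ∈ Φ, Δ.face d = some f → Δ.face d' = some f → d.1 ∈ X → d'.1 ∈ X) →
    (∀ d ∈ p, d.1 ∉ X) → X = ∅

namespace IsPart

variable {Δ} {A : Set Δ.E} {Φ : Set Δ.F} {p : List (Δ.E × Bool)}

theorem not_face (H : Δ.IsPart A Φ p) {d : Δ.E × Bool} (hd : d ∈ p) {f : Δ.F} (hf : f ∈ Φ) :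
    Δ.face d ≠ some f :=
  fun h => (H.mem_iff d (H.mem_edges d hd)).1 hd ⟨f, hf, h⟩

/-- A cell of `Φ` has all of its edges in `B` or none, so a cocycle on `B` extends by zero to one on
`A`, and the vanishing of cohomology is inherited. Used for the two sides of a bridge. -/
theorem restrict (H : Δ.IsPart A Φ p) {B : Set Δ.E} (hB : B ⊆ A) {q : List (Δ.E × Bool)}
    (hq : q.Nodup) (hcl : ∃ u, Δ.IsPath u q u) (hmem : ∀ d, d ∈ q ↔ d ∈ p ∧ d.1 ∈ B)
    (hface : ∀ d d', ∀ f ∈ Φ, Δ.face d = some f → Δ.face d' = some f → d.1 ∈ B → d'.1 ∈ B) :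
    Δ.IsPart B {f ∈ Φ | ∃ d, Δ.face d = some f ∧ d.1 ∈ B} q where
  nodup := hq
  closed := hcl
  mem_edges d hd := ((hmem d).1 hd).2
  face_edges := by
    rintro d f ⟨hf, d', hd', hB'⟩ hd
    exact hface _ _ f hf hd' hd hB'
  mem_iff d hd := by
    rw [hmem, H.mem_iff d (hB hd)]
    constructor
    · rintro ⟨h, -⟩ ⟨f, ⟨hf, -⟩, hdf⟩
      exact h ⟨f, hf, hdf⟩
    · exact fun h => ⟨fun ⟨f, hf, hdf⟩ => h ⟨f, ⟨hf, d, hdf, hd⟩, hdf⟩, hd⟩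
  potential c hc := by
    classical
    obtain ⟨g, hg⟩ := H.potential (fun e => if e ∈ B then c e else 0) (by
      intro d f hf hdf
      by_cases hd : d.1 ∈ B
      · rw [← hc d f ⟨hf, d, hdf, hd⟩ hdf]
        refine Δ.pathSum_congr fun d' hd' => if_pos ?_
        exact hface _ _ f hf hdf ((Δ.mem_facePath.1 hd').trans hdf) hd
      · rw [Δ.pathSum_congr (c' := 0)]
        · simp [pathSum]
        · refine fun d' hd' => if_neg fun hd'' => hd ?_
          exact hface _ _ f hf ((Δ.mem_facePath.1 hd').trans hdf) hdf hd'')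
    exact ⟨g, fun e he => by rw [← hg e (hB he), if_pos he]⟩
  meets X hX hcl hdis := by
    refine H.meets X (hX.trans hB) ?_ ?_
    · intro d d' f hf hd hd' hdX
      exact hcl d d' f ⟨hf, d, hd, hX hdX⟩ hd hd' hdX
    · intro d hd hdX
      exact hdis d ((hmem d).2 ⟨hd, hX hdX⟩) hdX

/-- Within the part, `d` is a free edge of the cell `f`, so removing both is a collapse: cohomology
still vanishes, and the rest `S` of the boundary of `f` replaces `d` on the boundary. -/
theorem delete_cell {d : Δ.E × Bool} (H : Δ.IsPart A Φ (d :: p)) (hd : flip d ∉ d :: p)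
    {f : Δ.F} (hf : f ∈ Φ) (hdf : Δ.face (flip d) = some f) {S : List (Δ.E × Bool)}
    (hS : Δ.facePath (flip d) = flip d :: S) :
    Δ.IsPart (A \ {d.1}) (Φ \ {f}) (S ++ p) := by
  classical
  have hnd := H.nodup
  have hndS := Δ.nodup_facePath (flip d)
  rw [hS] at hndS
  have hSf : ∀ a ∈ S, Δ.face a = some f := fun a ha =>
    (Δ.mem_facePath.1 (by rw [hS]; exact List.mem_cons_of_mem _ ha)).trans hdf
  have hSe : ∀ a ∈ S, a.1 ≠ d.1 := by
    intro a ha he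
    rcases eq_or_eq_flip he with rfl | rfl
    · exact H.not_face List.mem_cons_self hf (hSf a ha)
    · exact (List.nodup_cons.1 hndS).1 ha
  have hpe : ∀ a ∈ p, a.1 ≠ d.1 := by
    intro a ha he
    rcases eq_or_eq_flip he with rfl | rfl
    · exact (List.nodup_cons.1 hnd).1 ha
    · exact hd (List.mem_cons_of_mem _ ha)
  have hfe : ∀ a, ∀ f' ∈ Φ \ {f}, Δ.face a = some f' → a.1 ≠ d.1 := by
    rintro a f' ⟨hf', hne⟩ haf he
    rcases eq_or_eq_flip he with rfl | rfl
    · exact H.not_face List.mem_cons_self hf' haf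
    · exact hne (Option.some_injective _ (haf.symm.trans hdf))
  have hSmem : ∀ a, Δ.face a = some f → a.1 ≠ d.1 → a ∈ S := by
    intro a ha hne
    have : a ∈ Δ.facePath (flip d) := Δ.mem_facePath.2 (ha.trans hdf.symm)
    rw [hS, List.mem_cons] at this
    rcases this with rfl | h
    · exact absurd rfl hne
    · exact h
  constructor
  · refine List.Nodup.append (List.nodup_cons.1 hndS).2 (List.nodup_cons.1 hnd).2 ?_
    intro a ha ha'
    exact H.not_face (List.mem_cons_of_mem _ ha') hf (hSf a ha)
  · obtain ⟨u, hu, hp⟩ := H.closed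
    have h1 := Δ.isPath_facePath (flip d)
    rw [hS] at h1
    have h2 := h1.2
    rw [tgt_flip, hu] at h2
    exact ⟨u, Δ.isPath_append.2 ⟨_, h2, hp⟩⟩
  · intro a ha
    rcases List.mem_append.1 ha with ha | ha
    · exact ⟨H.face_edges a f hf (hSf a ha), hSe a ha⟩
    · exact ⟨H.mem_edges a (List.mem_cons_of_mem _ ha), hpe a ha⟩
  · exact fun a f' hf' haf => ⟨H.face_edges a f' hf'.1 haf, hfe a f' hf' haf⟩
  · rintro a ⟨haA, hae⟩
    constructor
    · rintro ha ⟨f', ⟨hf', hne⟩, haf⟩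
      rcases List.mem_append.1 ha with ha | ha
      · exact hne (Option.some_injective _ (haf.symm.trans (hSf a ha)))
      · exact H.not_face (List.mem_cons_of_mem _ ha) hf' haf
    · intro h
      rw [List.mem_append, or_iff_not_imp_left]
      intro haS
      have : a ∈ d :: p := by
        rw [H.mem_iff a haA]
        rintro ⟨f', hf', haf⟩
        refine h ⟨f', ⟨hf', ?_⟩, haf⟩
        rintro rfl
        exact haS (hSmem a haf hae)
      rcases List.mem_cons.1 this with rfl | h
      · exact absurd rfl hae
      · exact h
  · intro c hc
    -- The cocycle is extended over `d` by the only value for which the sum around `f` vanishes.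
    obtain ⟨g, hg⟩ := H.potential (Function.update c d.1 (Δ.pathSum c S)) (by
      intro a f' hf' haf
      by_cases hff : f' = f
      · subst hff
        rw [Δ.pathSum_perm _ (Δ.facePath_isRotated (haf.trans hdf.symm)).perm, hS, pathSum_cons,
          show (flip d).1 = d.1 from rfl, Function.update_self,
          Δ.pathSum_congr (c' := c) fun a ha => Function.update_of_ne (hSe a ha) _ _]
        exact CharTwo.add_self_eq_zero _
      · rw [← hc a f' ⟨hf', hff⟩ haf]
        refine Δ.pathSum_congr fun b hb => Function.update_of_ne ?_ _ _
        exact hfe b f' ⟨hf', hff⟩ ((Δ.mem_facePath.1 hb).trans haf))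
    exact ⟨g, fun e he => by rw [← hg e he.1, Function.update_of_ne he.2]⟩
  · intro X hX hcl hdis
    refine H.meets X (hX.trans Set.sdiff_subset) ?_ ?_
    · intro a a' f' hf' haf haf' haX
      by_cases hff : f' = f
      · subst hff
        exact absurd haX (hdis a (List.mem_append_left _ (hSmem a haf (hX haX).2)))
      · exact hcl a a' f' ⟨hf', hff⟩ haf haf' haX
    · intro a ha haX
      rcases List.mem_cons.1 ha with rfl | ha
      · exact (hX haX).2 rfl
      · exact hdis a (List.mem_append_right _ ha) haX

end IsPart

theorem sameCycle_iff {α : Type*} [Finite α] {σ : Equiv.Perm α} {P : α → Prop}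
    (hP : ∀ x, P (σ x) ↔ P x) {x y : α} (h : σ.SameCycle x y) : P x ↔ P y := by
  obtain ⟨n, rfl⟩ := h.exists_nat_pow_eq
  induction n with
  | zero => rfl
  | succ n ih =>
    rw [ih ⟨n, by simp⟩, pow_succ', Equiv.Perm.mul_apply, hP]

theorem isPart_univ (hc : Δ.Connected) (hs : Δ.SimplyConnected) {d : Δ.E × Bool}
    (hd : Δ.face d = none) : Δ.IsPart Set.univ Set.univ (Δ.facePath d) where
  nodup := Δ.nodup_facePath d
  closed := ⟨_, Δ.isPath_facePath d⟩
  mem_edges _ _ := trivial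
  face_edges _ _ _ _ := trivial
  mem_iff a _ := by
    rw [Δ.mem_facePath, hd, Option.eq_none_iff_forall_ne_some]
    simp
  potential c h := by
    obtain ⟨g, hg⟩ := Δ.exists_potential hc hs c fun d f => h d f trivial
    exact ⟨g, fun e _ => hg e⟩
  meets X _ hcl hdis := by
    have := Δ.finite_E
    by_contra hne
    obtain ⟨e, he⟩ := Set.nonempty_iff_ne_empty.2 hne
    -- A set of unoriented edges that is stable under `next` is stable under the rotation about each
    -- vertex. By connectedness it would then reach the outer face.
    have hnext : ∀ a, (Δ.next a).1 ∈ X ↔ a.1 ∈ X := by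
      intro a
      have hface : Δ.face (Δ.next a) = Δ.face a := (Δ.face_eq_iff _ _).2 ⟨-1, by simp⟩
      cases ha : Δ.face a with
      | none =>
        have h1 := hdis a (Δ.mem_facePath.2 (ha.trans hd.symm))
        have h2 := hdis (Δ.next a) (Δ.mem_facePath.2 (hface.trans (ha.trans hd.symm)))
        simp [h1, h2]
      | some f =>
        exact ⟨hcl _ _ f trivial (hface.trans ha) ha, hcl _ _ f trivial ha (hface.trans ha)⟩
    have hsrc : ∀ a b, Δ.src a = Δ.src b → a.1 ∈ X → b.1 ∈ X := by
      intro a b hab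
      refine (sameCycle_iff (P := fun a => a.1 ∈ X) (fun a => ?_)
        ((Δ.src_eq_iff a b).1 hab)).1
      exact hnext _
    have hpath : ∀ q u v, Δ.IsPath u q v → (∃ a, Δ.src a = u ∧ a.1 ∈ X) →
        ∀ b, Δ.src b = v → b.1 ∈ X := by
      intro q
      induction q with
      | nil =>
        rintro u v rfl ⟨a, ha, haX⟩ b hb
        exact hsrc a b (ha.trans hb.symm) haX
      | cons a q ih =>
        rintro u v ⟨ha, hq⟩ ⟨a', ha', haX⟩
        exact ih _ _ hq ⟨Δ.inv a, rfl, (hsrc a' a (ha'.trans ha.symm) haX :)⟩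
    obtain ⟨q, hq⟩ := hc.2 (Δ.src (e, true)) (Δ.src d)
    exact hdis d (Δ.mem_facePath.2 rfl) (hpath q _ _ hq ⟨_, rfl, he⟩ d rfl)

end SurfaceComplex

/-! ### From diagrams to fillings -/

namespace Diagram

variable {A : Type} {R : Set (List (A × Bool))} (Δ : Diagram R)

theorem label_flip (d : Δ.E × Bool) : Δ.label (flip d) = flip (Δ.label d) := rfl

/-- The edge `d` borders no cell of the part, so its indicator function is a cocycle. A potential
`g` of it colours the vertices with two colours so that, within the part, only `d` joins different
colours; hence `d` separates the part, with `U` on the side of its end and `V` on the side of its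
start. This stands in for the Jordan curve theorem. -/
theorem fill_bridge {B : Set Δ.E} {Φ : Set Δ.F} {d : Δ.E × Bool} {U V : List (Δ.E × Bool)}
    (H : Δ.IsPart B Φ (d :: (U ++ flip d :: V))) {n : ℕ} (hn : B.ncard = n)
    (ih : ∀ m < n, ∀ (C : Set Δ.E) (Ψ : Set Δ.F) (p : List (Δ.E × Bool)),
      Δ.IsPart C Ψ p → C.ncard = m → ∃ k, Fill R m k (p.map Δ.label)) :
    ∃ k, Fill R n k ((d :: (U ++ flip d :: V)).map Δ.label) := by
  classical
  have hfin := Δ.finite_E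
  have hnd := H.nodup
  obtain ⟨hnd1, hnd2⟩ := List.nodup_cons.1 hnd
  have hUV := List.nodup_append.1 hnd2
  have hVd := List.nodup_cons.1 hUV.2.1
  have hUe : ∀ a ∈ U, a.1 ≠ d.1 := by
    intro a ha he
    rcases eq_or_eq_flip he with rfl | rfl
    · exact hnd1 (List.mem_append_left _ ha)
    · exact hUV.2.2 _ ha _ List.mem_cons_self rfl
  have hVe : ∀ a ∈ V, a.1 ≠ d.1 := by
    intro a ha he
    rcases eq_or_eq_flip he with rfl | rfl
    · exact hnd1 (List.mem_append_right _ (List.mem_cons_of_mem _ ha))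
    · exact hVd.1 ha
  have hUp : ∀ a ∈ U, a ∈ d :: (U ++ flip d :: V) := fun a ha => by simp [ha]
  have hVp : ∀ a ∈ V, a ∈ d :: (U ++ flip d :: V) := fun a ha => by simp [ha]
  have hfe : ∀ a, ∀ f ∈ Φ, Δ.face a = some f → a.1 ≠ d.1 := by
    intro a f hf haf he
    rcases eq_or_eq_flip he with rfl | rfl
    · exact H.not_face List.mem_cons_self hf haf
    · exact H.not_face (by simp) hf haf
  obtain ⟨g, hg⟩ := H.potential (fun e => if e = d.1 then 1 else 0) (by
    intro a f hf haf
    rw [Δ.pathSum_congr (c' := 0)]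
    · simp [SurfaceComplex.pathSum]
    · exact fun b hb => if_neg (hfe b f hf ((Δ.mem_facePath.1 hb).trans haf)))
  have hends : ∀ a : Δ.E × Bool,
      g (Δ.src (a.1, true)) + g (Δ.src (a.1, false)) = g (Δ.src a) + g (Δ.tgt a) := by
    rintro ⟨e, b⟩
    cases b
    · exact add_comm _ _
    · rfl
  have hd1 : g (Δ.src d) + g (Δ.tgt d) = 1 := by
    rw [← hends, ← hg _ (H.mem_edges d List.mem_cons_self), if_pos rfl]
  have hside : ∀ a : Δ.E × Bool, a.1 ∈ B → a.1 ≠ d.1 → g (Δ.tgt a) = g (Δ.src a) := by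
    intro a ha hne
    have := hg a.1 ha
    rw [if_neg hne, hends] at this
    exact (CharTwo.add_eq_zero.1 this.symm).symm
  have hside' : ∀ a : Δ.E × Bool, a.1 ∈ B → a.1 ≠ d.1 → g (Δ.src (a.1, true)) = g (Δ.src a) := by
    rintro ⟨e, b⟩ ha hne
    cases b
    · exact hside (e, false) ha hne
    · rfl
  have hpath : ∀ (q : List (Δ.E × Bool)) (u v : Δ.V), Δ.IsPath u q v →
      (∀ a ∈ q, a.1 ∈ B ∧ a.1 ≠ d.1) → ∀ a ∈ q, g (Δ.src a) = g u := by
    intro q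
    induction q with
    | nil => simp
    | cons b q ihq =>
      rintro u v ⟨rfl, hq⟩ hB a ha
      rcases List.mem_cons.1 ha with rfl | ha
      · rfl
      · rw [ihq _ _ hq (fun a ha => hB a (List.mem_cons_of_mem _ ha)) a ha]
        exact hside b (hB b List.mem_cons_self).1 (hB b List.mem_cons_self).2
  have hface : ∀ t : ZMod 2, ∀ a a', ∀ f ∈ Φ, Δ.face a = some f → Δ.face a' = some f →
      a.1 ∈ {e ∈ B | e ≠ d.1 ∧ g (Δ.src (e, true)) = t} →
      a'.1 ∈ {e ∈ B | e ≠ d.1 ∧ g (Δ.src (e, true)) = t} := by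
    rintro t a a' f hf haf haf' ⟨haB, hae, hat⟩
    refine ⟨H.face_edges a' f hf haf', hfe a' f hf haf', ?_⟩
    rw [hside' a' (H.face_edges a' f hf haf') (hfe a' f hf haf'), ← hat, hside' a haB hae]
    refine hpath _ _ _ (Δ.isPath_facePath a) (fun b hb => ?_) a'
      (Δ.mem_facePath.2 (haf'.trans haf.symm))
    have hb := (Δ.mem_facePath.1 hb).trans haf
    exact ⟨H.face_edges b f hf hb, hfe b f hf hb⟩
  obtain ⟨u, hu, hp⟩ := H.closed
  obtain ⟨w, hpU, hw, hpV⟩ := Δ.isPath_append.1 hp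
  rw [Δ.tgt_flip, hu] at hpV
  have hw : Δ.tgt d = w := hw
  subst hw hu
  have hgU : ∀ a ∈ U, g (Δ.src (a.1, true)) = g (Δ.tgt d) := fun a ha => by
    rw [hside' a (H.mem_edges a (hUp a ha)) (hUe a ha)]
    exact hpath _ _ _ hpU (fun b hb => ⟨H.mem_edges b (hUp b hb), hUe b hb⟩) a ha
  have hgV : ∀ a ∈ V, g (Δ.src (a.1, true)) = g (Δ.src d) := fun a ha => by
    rw [hside' a (H.mem_edges a (hVp a ha)) (hVe a ha)]
    exact hpath _ _ _ hpV (fun b hb => ⟨H.mem_edges b (hVp b hb), hVe b hb⟩) a ha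
  have hne : g (Δ.src d) ≠ g (Δ.tgt d) := fun h => by
    rw [h, CharTwo.add_self_eq_zero] at hd1
    exact zero_ne_one hd1
  have H1 := H.restrict (B := {e ∈ B | e ≠ d.1 ∧ g (Δ.src (e, true)) = g (Δ.tgt d)})
    (fun e he => he.1) hUV.1 ⟨_, hpU⟩ (fun a => by
      constructor
      · exact fun ha => ⟨hUp a ha, H.mem_edges a (hUp a ha), hUe a ha, hgU a ha⟩
      · rintro ⟨ha, -, hae, hat⟩
        rcases List.mem_cons.1 ha with rfl | ha
        · exact absurd rfl hae
        rcases List.mem_append.1 ha with ha | ha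
        · exact ha
        rcases List.mem_cons.1 ha with rfl | ha
        · exact absurd rfl hae
        · exact absurd ((hgV a ha).symm.trans hat) hne) (hface _)
  have H2 := H.restrict (B := {e ∈ B | e ≠ d.1 ∧ g (Δ.src (e, true)) = g (Δ.src d)})
    (fun e he => he.1) hVd.2 ⟨_, hpV⟩ (fun a => by
      constructor
      · exact fun ha => ⟨hVp a ha, H.mem_edges a (hVp a ha), hVe a ha, hgV a ha⟩
      · rintro ⟨ha, -, hae, hat⟩
        rcases List.mem_cons.1 ha with rfl | ha
        · exact absurd rfl hae
        rcases List.mem_append.1 ha with ha | ha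
        · exact absurd (hat.symm.trans (hgU a ha)) hne
        rcases List.mem_cons.1 ha with rfl | ha
        · exact absurd rfl hae
        · exact ha) (hface _)
  have hcard : {e ∈ B | e ≠ d.1 ∧ g (Δ.src (e, true)) = g (Δ.tgt d)}.ncard +
      {e ∈ B | e ≠ d.1 ∧ g (Δ.src (e, true)) = g (Δ.src d)}.ncard + 1 = n := by
    rw [← Set.ncard_union_eq, ← hn,
      ← Set.ncard_sdiff_singleton_add_one (H.mem_edges d List.mem_cons_self)]
    · congr 2
      ext e
      have : ∀ x y z : ZMod 2, x + y = 1 → (z = y ∨ z = x) := by decide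
      have := this _ _ (g (Δ.src (e, true))) hd1
      simp only [Set.mem_union, Set.mem_ofPred_eq, Set.mem_sdiff, Set.mem_singleton_iff]
      tauto
    · rw [Set.disjoint_left]
      rintro e ⟨-, -, h1⟩ ⟨-, -, h2⟩
      exact hne (h2.symm.trans h1)
  obtain ⟨k₁, hk₁⟩ := ih _ (by omega) _ _ _ H1 rfl
  obtain ⟨k₂, hk₂⟩ := ih _ (by omega) _ _ _ H2 rfl
  exact ⟨_, (Fill.bridge (Δ.label d) _ _ hk₁ hk₂).cast hcard rfl (by simp [label_flip])⟩

theorem fill_of_isPart (n : ℕ) : ∀ (B : Set Δ.E) (Φ : Set Δ.F) (p : List (Δ.E × Bool)),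
    Δ.IsPart B Φ p → B.ncard = n → ∃ k, Fill R n k (p.map Δ.label) := by
  have hfin := Δ.finite_E
  induction n using Nat.strong_induction_on with
  | _ n ih =>
    intro B Φ p H hn
    cases p with
    | nil =>
      -- An empty boundary could otherwise belong to a closed surface; `meets` excludes this.
      have : B = ∅ := H.meets B subset_rfl (fun _ b f hf _ hb _ => H.face_edges b f hf hb) (by simp)
      subst this
      obtain rfl : 0 = n := by simpa using hn
      exact ⟨0, Fill.nil⟩
    | cons d p =>
      have hdB := H.mem_edges d List.mem_cons_self
      by_cases hd : flip d ∈ d :: p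
      · have hdp : flip d ∈ p := (List.mem_cons.1 hd).resolve_left (flip_ne d)
        obtain ⟨U, V, rfl⟩ := List.append_of_mem hdp
        exact Δ.fill_bridge H hn fun m hm C Ψ q hC hCm => ih m hm C Ψ q hC hCm
      · have hex : ∃ f ∈ Φ, Δ.face (flip d) = some f := by
          by_contra h
          exact hd ((H.mem_iff (flip d) hdB).2 h)
        obtain ⟨f, hf, hdf⟩ := hex
        obtain ⟨S, hS⟩ := Δ.facePath_eq_cons (flip d)
        have hcard : (B \ {d.1}).ncard + 1 = n := by
          rw [Set.ncard_sdiff_singleton_add_one hdB, hn]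
        obtain ⟨k, hk⟩ := ih _ (by omega) _ _ _ (H.delete_cell hd hf hdf hS) rfl
        have hr : flip (Δ.label d) :: S.map Δ.label ∈ cyclicRelators R := by
          have := Δ.relator (flip d) f hdf
          rw [hS] at this
          exact this
        rw [List.map_append] at hk
        exact ⟨k + 1, (Fill.cell _ _ _ hr hk).cast hcard rfl rfl⟩

theorem exists_fill {W : List (A × Bool)} (h : Δ.HasBoundaryLabel W) :
    ∃ k, Fill R Δ.numEdges k W := by
  rcases h with ⟨hE, rfl⟩ | ⟨d, hd, hW⟩
  · exact ⟨0, Fill.nil.cast (by simp [numEdges]) rfl rfl⟩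
  · obtain ⟨k, hk⟩ := Δ.fill_of_isPart _ _ _ _
      (Δ.isPart_univ Δ.connected Δ.simplyConnected hd) rfl
    rw [Set.ncard_univ] at hk
    exact ⟨k, hk.of_isRotated hW⟩

end Diagram

/-! ### Walks and their homotopies -/

section Walks

variable {E V : Type}

/-- `IsWalk src u p v`: the sequence `p` of oriented edges is a path from `u` to `v` in the graph
in which `src` gives the initial vertices. -/
def IsWalk (src : E × Bool → V) : V → List (E × Bool) → V → Prop
  | u, [], v => u = v
  | u, d :: p, v => src d = u ∧ IsWalk src (src (flip d)) p v

theorem isWalk_append {src : E × Bool → V} {u v : V} {p q : List (E × Bool)} :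
    IsWalk src u (p ++ q) v ↔ ∃ w, IsWalk src u p w ∧ IsWalk src w q v := by
  induction p generalizing u with
  | nil => simp [IsWalk]
  | cons d p ih => simp [IsWalk, ih, and_assoc]

theorem IsWalk.append {src : E × Bool → V} {u v w : V} {p q : List (E × Bool)}
    (hp : IsWalk src u p w) (hq : IsWalk src w q v) : IsWalk src u (p ++ q) v :=
  isWalk_append.2 ⟨w, hp, hq⟩

theorem isWalk_single {src : E × Bool → V} (d : E × Bool) :
    IsWalk src (src d) [d] (src (flip d)) := ⟨rfl, rfl⟩

theorem isWalk_pair {src : E × Bool → V} (d : E × Bool) :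
    IsWalk src (src d) [d, flip d] (src d) := ⟨rfl, rfl, congrArg src (flip_flip d)⟩

theorem IsWalk.invRev {src : E × Bool → V} {u v : V} {p : List (E × Bool)}
    (h : IsWalk src u p v) : IsWalk src v (FreeGroup.invRev p) u := by
  induction p generalizing u with
  | nil => exact (show u = v from h).symm
  | cons d p ih =>
    rw [invRev_cons_flip]
    exact (ih h.2).append ⟨rfl, by rw [flip_flip]; exact h.1⟩

theorem IsWalk.unique {src : E × Bool → V} {u v v' : V} {p : List (E × Bool)}
    (h : IsWalk src u p v) (h' : IsWalk src u p v') : v = v' := by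
  induction p generalizing u with
  | nil => exact (show u = v from h).symm.trans h'
  | cons d p ih => exact ih h.2 h'.2

theorem IsWalk.comp {src : E × Bool → V} {u v : V} {p : List (E × Bool)}
    (h : IsWalk src u p v) {T : Type} (g : V → T) : IsWalk (g ∘ src) (g u) p (g v) := by
  induction p generalizing u with
  | nil => exact congrArg g h
  | cons d p ih => exact ⟨congrArg g h.1, ih h.2⟩

theorem isWalk_map {E' : Type} (i : E → E') {src : E' × Bool → V} {u v : V}
    {p : List (E × Bool)} :
    IsWalk src u (p.map (Prod.map i id)) v ↔ IsWalk (src ∘ Prod.map i id) u p v := by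
  induction p generalizing u with
  | nil => rfl
  | cons d p ih => exact and_congr_right fun _ => ih

theorem isWalk_rotate {src : E × Bool → V} {u : V} {p q : List (E × Bool)}
    (h : IsWalk src u (p ++ q) u) : ∃ w, IsWalk src w (q ++ p) w := by
  obtain ⟨w, h1, h2⟩ := isWalk_append.1 h
  exact ⟨w, h2.append h1⟩

variable {F : Type}

/-- Elementary homotopies of walks from `u` to `v`, where the 2-cells are given by their boundary
walks. -/
inductive WalkStep (src : E × Bool → V) (cells : F → List (E × Bool)) (u v : V) :
    List (E × Bool) → List (E × Bool) → Prop
  | backtrack (p q : List (E × Bool)) (d : E × Bool) : IsWalk src u p (src d) →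
      IsWalk src (src d) q v → WalkStep src cells u v (p ++ q) (p ++ [d, flip d] ++ q)
  | cell (p q : List (E × Bool)) (f : F) (w : V) : IsWalk src u p w →
      IsWalk src w (cells f) w → IsWalk src w q v →
      WalkStep src cells u v (p ++ q) (p ++ cells f ++ q)

/-- Homotopy of walks from `u` to `v`. -/
def Homotopic (src : E × Bool → V) (cells : F → List (E × Bool)) (u v : V) :
    List (E × Bool) → List (E × Bool) → Prop :=
  Relation.EqvGen (WalkStep src cells u v)

namespace Homotopic

variable {src : E × Bool → V} {cells : F → List (E × Bool)} {u v w : V}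
  {p q r : List (E × Bool)}

theorem refl (p : List (E × Bool)) : Homotopic src cells u v p p := Relation.EqvGen.refl p

theorem symm (h : Homotopic src cells u v p q) : Homotopic src cells u v q p :=
  Relation.EqvGen.symm _ _ h

theorem trans (h : Homotopic src cells u v p q) (h' : Homotopic src cells u v q r) :
    Homotopic src cells u v p r :=
  Relation.EqvGen.trans _ _ _ h h'

theorem lift {E' V' F' : Type} {src' : E' × Bool → V'} {cells' : F' → List (E' × Bool)}
    {u' v' : V'} {φ : List (E × Bool) → List (E' × Bool)}
    (hφ : ∀ p q, WalkStep src cells u v p q → Homotopic src' cells' u' v' (φ p) (φ q))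
    (h : Homotopic src cells u v p q) : Homotopic src' cells' u' v' (φ p) (φ q) := by
  induction h with
  | rel _ _ h => exact hφ _ _ h
  | refl => exact refl _
  | symm _ _ _ ih => exact ih.symm
  | trans _ _ _ _ _ ih1 ih2 => exact ih1.trans ih2

theorem insert_pair {d : E × Bool} (hp : IsWalk src u p (src d)) (hq : IsWalk src (src d) q v) :
    Homotopic src cells u v (p ++ q) (p ++ [d, flip d] ++ q) :=
  Relation.EqvGen.rel _ _ (WalkStep.backtrack p q d hp hq)

theorem insert_cell {f : F} (hp : IsWalk src u p w) (hf : IsWalk src w (cells f) w)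
    (hq : IsWalk src w q v) : Homotopic src cells u v (p ++ q) (p ++ cells f ++ q) :=
  Relation.EqvGen.rel _ _ (WalkStep.cell p q f w hp hf hq)

theorem append_left (h : Homotopic src cells u v p q) (hr : IsWalk src w r u) :
    Homotopic src cells w v (r ++ p) (r ++ q) := by
  refine lift (φ := fun p => r ++ p) ?_ h
  rintro _ _ (⟨p, q, d, hp, hq⟩ | ⟨p, q, f, x, hp, hf, hq⟩)
  · simpa using insert_pair (cells := cells) (hr.append hp) hq
  · simpa using insert_cell (hr.append hp) hf hq

theorem append_right (h : Homotopic src cells u v p q) (hr : IsWalk src v r w) :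
    Homotopic src cells u w (p ++ r) (q ++ r) := by
  refine lift (φ := fun p => p ++ r) ?_ h
  rintro _ _ (⟨p, q, d, hp, hq⟩ | ⟨p, q, f, x, hp, hf, hq⟩)
  · simpa using insert_pair (cells := cells) hp (hq.append hr)
  · simpa using insert_cell hp hf (hq.append hr)

theorem map {E' V' F' : Type} {src' : E' × Bool → V'} {cells' : F' → List (E' × Bool)}
    (i : E → E') (g : V → V') (j : F → F') (hsrc : src' ∘ Prod.map i id = g ∘ src)
    (hcells : ∀ f, cells' (j f) = (cells f).map (Prod.map i id))
    (h : Homotopic src cells u v p q) :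
    Homotopic src' cells' (g u) (g v) (p.map (Prod.map i id)) (q.map (Prod.map i id)) := by
  have hw : ∀ {u v p}, IsWalk src u p v →
      IsWalk src' (g u) (p.map (Prod.map i id)) (g v) := by
    intro u v p h
    rw [isWalk_map, hsrc]
    exact h.comp (T := V') g
  refine lift (φ := fun p => p.map (Prod.map i id)) ?_ h
  rintro _ _ (⟨p, q, d, hp, hq⟩ | ⟨p, q, f, x, hp, hf, hq⟩)
  · have hd : g (src d) = src' (Prod.map i id d) := (congrFun hsrc d).symm
    have hp := hw hp
    have hq := hw hq
    rw [hd] at hp hq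
    simpa [flip] using insert_pair (cells := cells') hp hq
  · have hf := hw hf
    rw [← hcells] at hf
    simpa [hcells] using insert_cell (hw hp) hf (hw hq)

theorem backtrack (d : E × Bool) : Homotopic src cells (src d) (src d) [d, flip d] [] :=
  (Relation.EqvGen.rel _ _ (WalkStep.backtrack [] [] d rfl rfl)).symm

theorem cell (f : F) (hf : IsWalk src w (cells f) w) : Homotopic src cells w w (cells f) [] := by
  have := WalkStep.cell (cells := cells) (u := w) (v := w) [] [] f w rfl hf rfl
  exact (Relation.EqvGen.rel _ _ (by simpa using this)).symm

theorem invRev_append (hp : IsWalk src u p v) :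
    Homotopic src cells v v (FreeGroup.invRev p ++ p) [] := by
  induction p generalizing u with
  | nil => exact refl _
  | cons d p ih =>
    rw [invRev_cons_flip]
    have h1 := backtrack (src := src) (cells := cells) (flip d)
    rw [flip_flip] at h1
    have h2 := (h1.append_right hp.2).append_left hp.2.invRev
    have h3 := h2.trans (ih hp.2)
    simpa using h3

end Homotopic

/-- A choice of paths from `v₀` to all vertices that is compatible with all edges up to
homotopy. -/
structure IsPathChoice (src : E × Bool → V) (cells : F → List (E × Bool)) (v₀ : V)
    (γ : V → List (E × Bool)) : Prop where
  walk : ∀ v, IsWalk src v₀ (γ v) v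
  base : Homotopic src cells v₀ v₀ (γ v₀) []
  edge : ∀ d, Homotopic src cells v₀ (src (flip d)) (γ (src d) ++ [d]) (γ (src (flip d)))

section

variable {src : E × Bool → V} {cells : F → List (E × Bool)} {v₀ : V} {γ : V → List (E × Bool)}

theorem homotopic_flip {d : E × Bool} (hw : IsWalk src v₀ (γ (src d)) (src d))
    (h : Homotopic src cells v₀ (src (flip d)) (γ (src d) ++ [d]) (γ (src (flip d)))) :
    Homotopic src cells v₀ (src (flip (flip d))) (γ (src (flip d)) ++ [flip d])
      (γ (src (flip (flip d)))) := by
  have h1 := h.symm.append_right (isWalk_single (flip d))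
  refine h1.trans ?_
  rw [flip_flip]
  simpa using (Homotopic.backtrack (cells := cells) d).append_left hw

theorem homotopic_of_edges {u v : V} {p : List (E × Bool)}
    (he : ∀ d ∈ p, Homotopic src cells v₀ (src (flip d)) (γ (src d) ++ [d]) (γ (src (flip d))))
    (hp : IsWalk src u p v) : Homotopic src cells v₀ v (γ u ++ p) (γ v) := by
  induction p generalizing u with
  | nil =>
    obtain rfl : u = v := hp
    rw [List.append_nil]
    exact Homotopic.refl _
  | cons d p ih =>
    obtain ⟨rfl, hp⟩ := hp
    have h1 := (he d List.mem_cons_self).append_right hp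
    have h2 := ih (fun a ha => he a (List.mem_cons_of_mem _ ha)) hp
    simpa using h1.trans h2

/-- The chosen paths absorb the edges of `p` one by one, so `γ v` followed by `p` is homotopic to `γ
v`, which cancels on the left. Simple connectivity thus becomes a condition on single edges, which
is easy to preserve under gluing. -/
theorem IsPathChoice.homotopic_nil (h : IsPathChoice src cells v₀ γ) {v : V}
    {p : List (E × Bool)} (hp : IsWalk src v p v) : Homotopic src cells v v p [] := by
  have h1 := homotopic_of_edges (fun d _ => h.edge d) hp
  have h2 := h1.append_left (h.walk v).invRev
  have h3 := Homotopic.invRev_append (cells := cells) (h.walk v)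
  have h4 := h3.append_right hp
  rw [List.append_assoc] at h4
  exact h4.symm.trans (h2.trans h3)

end

end Walks

/-! ### From fillings to planar complexes -/

/-- The combinatorial structure of a planar diagram, given by the closed walks around its faces:
`bd (some f)` is the boundary of the cell `f` and `bd none` that of the outer face. -/
structure IsDisc {A : Type} (R : Set (List (A × Bool))) {E V F : Type} (letter : E → A)
    (src : E × Bool → V) (face : E × Bool → Option F) (bd : Option F → List (E × Bool))
    (v₀ : V) : Prop where
  finite_E : Finite E
  finite_V : Finite V
  finite_F : Finite F
  nodup : ∀ o, (bd o).Nodup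
  mem_bd : ∀ d o, d ∈ bd o ↔ face d = o
  cell_ne_nil : ∀ f, bd (some f) ≠ []
  isEmpty : bd none = [] → IsEmpty E
  walk_outer : IsWalk src v₀ (bd none) v₀
  walk_cell : ∀ f, ∃ v, IsWalk src v (bd (some f)) v
  /-- `src` is universal among the labellings for which the boundaries of the faces are closed. -/
  universal : ∀ (X : E × Bool → Prop) (t : Prop), IsWalk X t (bd none) t →
    (∀ f, ∃ t, IsWalk X t (bd (some f)) t) → ∃ Y : V → Prop, Y v₀ = t ∧ X = Y ∘ src
  paths : ∃ γ, IsPathChoice src (fun f => bd (some f)) v₀ γ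
  card : Nat.card V + Nat.card F = Nat.card E + 1
  relator : ∀ f, (bd (some f)).map (Prod.map letter id) ∈ cyclicRelators R

section Construct

variable {A : Type} {R : Set (List (A × Bool))}

theorem isDisc_point : IsDisc R (E := Empty) (V := Unit) (F := Empty) Empty.elim (fun _ => ())
    (fun d => d.1.elim) (fun _ => []) () where
  finite_E := inferInstance
  finite_V := inferInstance
  finite_F := inferInstance
  nodup _ := List.nodup_nil
  mem_bd d := d.1.elim
  cell_ne_nil f := f.elim
  isEmpty _ := inferInstance
  walk_outer := rfl
  walk_cell f := f.elim
  universal _ t _ _ := ⟨fun _ => t, rfl, funext fun d => d.1.elim⟩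
  paths := ⟨fun _ => [], fun _ => rfl, Homotopic.refl _, fun d => d.1.elim⟩
  card := by simp
  relator f := f.elim

/-- The new edge joins the ends of the segment `s` of the outer boundary, and the new cell lies
between them. The vertices stay the same, and the outer sides of the edges of `s` pass to the new
cell. -/
theorem IsDisc.exists_add_cell {E V F : Type} {letter : E → A} {src : E × Bool → V}
    {face : E × Bool → Option F} {bd : Option F → List (E × Bool)} {v₀ : V}
    (H : IsDisc R letter src face bd v₀) {s w : List (E × Bool)} (hsw : bd none = s ++ w)
    (x : A × Bool) (hr : flip x :: s.map (Prod.map letter id) ∈ cyclicRelators R) :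
    ∃ (letter' : Option E → A) (src' : Option E × Bool → V)
      (face' : Option E × Bool → Option (Option F))
      (bd' : Option (Option F) → List (Option E × Bool)),
      IsDisc R letter' src' face' bd' v₀ ∧
        (bd' none).map (Prod.map letter' id) = x :: w.map (Prod.map letter id) := by
  classical
  have hfE := H.finite_E
  have hfF := H.finite_F
  have hwalk := H.walk_outer
  rw [hsw] at hwalk
  obtain ⟨v₁, hs, hw⟩ := isWalk_append.1 hwalk
  have hnd := H.nodup none
  rw [hsw] at hnd
  obtain ⟨hnds, hndw, hdisj⟩ := List.nodup_append'.1 hnd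
  have hmem := H.mem_bd
  have hface : ∀ d, d ∈ s ∨ d ∈ w ↔ face d = none := fun d => by
    rw [← hmem, hsw, List.mem_append]
  let i : E × Bool → Option E × Bool := Prod.map some id
  have hi : Function.Injective i := Function.Injective.prodMap (Option.some_injective _)
    Function.injective_id
  -- This orientation of the new edge is the one with label `x`.
  let e : Option E × Bool := (none, x.2)
  let src' : Option E × Bool → V := fun d =>
    d.1.elim (if d.2 = x.2 then v₀ else v₁) fun a => src (a, d.2)
  let face' : Option E × Bool → Option (Option F) := fun d =>
    d.1.elim (if d.2 = x.2 then none else some none) fun a =>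
      (face (a, d.2)).elim (if (a, d.2) ∈ s then some none else none) fun f => some (some f)
  let bd' : Option (Option F) → List (Option E × Bool) := fun o =>
    o.elim (e :: w.map i) fun o => o.elim (flip e :: s.map i) fun f => (bd (some f)).map i
  have hsrc : src' ∘ i = src := rfl
  have hsrc_e : src' e = v₀ := if_pos rfl
  have hsrc_e' : src' (flip e) = v₁ := if_neg (by simp [e, flip])
  have hws : ∀ {u v p}, IsWalk src u p v → IsWalk src' u (p.map i) v := fun h =>
    (isWalk_map some).2 h
  have hwc : IsWalk src' v₁ (bd' (some none)) v₁ := ⟨hsrc_e', by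
    rw [flip_flip, hsrc_e]; exact hws hs⟩
  let letter' : Option E → A := fun o => o.elim x.1 letter
  have hlab : ∀ l : List (E × Bool),
      (l.map i).map (Prod.map letter' id) = l.map (Prod.map letter id) := fun l =>
    List.map_map
  refine ⟨letter', src', face', bd', ?_, ?_⟩
  · constructor
    · infer_instance
    · exact H.finite_V
    · infer_instance
    · rintro (_ | _ | f)
      · exact List.nodup_cons.2 ⟨by simp [e, i], hndw.map hi⟩
      · exact List.nodup_cons.2 ⟨by simp [e, i, flip], hnds.map hi⟩
      · exact (H.nodup _).map hi
    · rintro ⟨_ | a, b⟩ (_ | _ | f)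
      · by_cases hb : b = x.2 <;> simp [bd', face', e, i, hb]
      · by_cases hb : b = x.2
        · simp [bd', face', e, i, flip, hb]
        · have : b = !x.2 := by cases b <;> cases hx : x.2 <;> simp_all
          simp [bd', face', e, i, flip, this]
      · by_cases hb : b = x.2 <;> simp [bd', face', i, hb]
      all_goals
        have h1 := hface (a, b)
        have h2 := @hdisj (a, b)
        have hm : ∀ l : List (E × Bool), (some a, b) ∈ l.map i ↔ (a, b) ∈ l := fun l =>
          List.mem_map_of_injective (f := i) (a := (a, b)) hi
      · have : (some a, b) ∈ bd' none ↔ (a, b) ∈ w := by simp [bd', e, hm]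
        rw [this]
        cases hf : face (a, b) <;> by_cases hs : (a, b) ∈ s <;> simp [face', hf, hs] <;> simp_all
      · have : (some a, b) ∈ bd' (some none) ↔ (a, b) ∈ s := by simp [bd', e, hm, flip]
        rw [this]
        cases hf : face (a, b) <;> by_cases hs : (a, b) ∈ s <;> simp_all [face']
      · have : (some a, b) ∈ bd' (some (some f)) ↔ (a, b) ∈ bd (some f) := by simp [bd', hm]
        rw [this, hmem]
        cases hf : face (a, b) <;> by_cases hs : (a, b) ∈ s <;> simp [face', hf, hs]
    · rintro (_ | f)
      · simp [bd']
      · simpa [bd'] using H.cell_ne_nil f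
    · intro h
      simp [bd'] at h
    · exact ⟨hsrc_e, by rw [hsrc_e']; exact hws hw⟩
    · rintro (_ | f)
      · exact ⟨v₁, hwc⟩
      · obtain ⟨v, hv⟩ := H.walk_cell f
        exact ⟨v, hws hv⟩
    -- A labelling that closes up around the new cell and the new outer face closes up around the
    -- old outer boundary `s w`, so the old universality applies.
    · rintro X t ⟨hX1, hX2⟩ hX
      obtain ⟨t', hX3, hX4⟩ := hX none
      subst hX3
      rw [flip_flip, hX1] at hX4
      have h2 := (isWalk_map some).1 hX2
      have h4 := (isWalk_map some).1 hX4
      obtain ⟨Y, hY1, hY2⟩ := H.universal (X ∘ i) t (by rw [hsw]; exact h4.append h2)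
        (fun f => by
          obtain ⟨t, ht⟩ := hX (some f)
          exact ⟨t, (isWalk_map some).1 ht⟩)
      have h5 : X (flip e) = Y v₁ := by
        have := hs.comp (T := Prop) Y
        rw [hY1, ← hY2] at this
        exact h4.unique this
      refine ⟨Y, hY1, funext ?_⟩
      rintro ⟨_ | a, b⟩
      · rcases eq_or_eq_flip (a := ((none : Option E), b)) (d := e) rfl with h | h <;> rw [h]
        · rw [hX1, Function.comp, hsrc_e, hY1]
        · rw [h5, Function.comp, hsrc_e']
      · exact congrFun hY2 (a, b)
    · obtain ⟨γ, hγ⟩ := H.paths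
      have hmap : ∀ {u v p q}, Homotopic src (fun f => bd (some f)) u v p q →
          Homotopic src' (fun f => bd' (some f)) u v (p.map i) (q.map i) := fun h =>
        h.map (src' := src') (cells' := fun f => bd' (some f)) some id some rfl fun _ => rfl
      have hold : ∀ d : E × Bool, Homotopic src' (fun f => bd' (some f)) v₀ (src' (flip (i d)))
          ((γ (src' (i d))).map i ++ [i d]) ((γ (src' (flip (i d)))).map i) := fun d => by
        have := hmap (hγ.edge d)
        rwa [List.map_append] at this
      have hbase := hmap hγ.base
      have hwk := fun v => hws (hγ.walk v)
      -- Inserting the new cell `e⁻¹ s` after `e` and cancelling `e e⁻¹` makes `e` homotopic to `s`,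
      -- whose edges are known to be compatible with `γ`.
      have hnew : Homotopic src' (fun f => bd' (some f)) v₀ (src' (flip e))
          ((γ (src' e)).map i ++ [e]) ((γ (src' (flip e))).map i) := by
        rw [hsrc_e']
        have h1 := homotopic_of_edges (cells := fun f => bd' (some f)) (γ := fun v => (γ v).map i)
          (p := s.map i) (fun d hd => by
            obtain ⟨a, -, rfl⟩ := List.mem_map.1 hd
            exact hold a) (hws hs)
        have hev : IsWalk src' v₀ [e] v₁ := ⟨hsrc_e, hsrc_e'⟩
        have h2 := (Homotopic.cell (cells := fun f => bd' (some f)) none hwc).append_left hev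
        have h3 := (Homotopic.backtrack (src := src') (cells := fun f => bd' (some f))
          e).append_right (r := s.map i) (w := v₁) (by rw [hsrc_e]; exact hws hs)
        rw [hsrc_e] at h3 ⊢
        have h4 := hbase.append_right (hws hs)
        have h5 := hbase.append_right hev
        exact h5.trans (h2.symm.trans (h3.trans (h4.symm.trans h1)))
      refine ⟨fun v => (γ v).map i, hwk, hbase, ?_⟩
      rintro ⟨_ | a, b⟩
      · rcases eq_or_eq_flip (a := ((none : Option E), b)) (d := e) rfl with h | h <;> rw [h]
        · exact hnew
        · exact homotopic_flip (γ := fun v => (γ v).map i) (hwk _) hnew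
      · exact hold (a, b)
    · have := H.card
      simp only [Finite.card_option]
      omega
    · rintro (_ | f)
      · have : (flip e :: s.map i).map (Prod.map letter' id) =
            flip x :: s.map (Prod.map letter id) := by rw [List.map_cons, hlab]; rfl
        exact this ▸ hr
      · exact (hlab _).symm ▸ H.relator f
  · exact (List.map_cons ..).trans (congrArg _ (hlab w))

/-- The bridge runs from `v₂` to `v₁`. The new outer boundary starts at `v₂`, crosses it, goes
around the first complex, comes back and goes around the second. -/
theorem IsDisc.exists_bridge {E₁ V₁ F₁ E₂ V₂ F₂ : Type} {letter₁ : E₁ → A} {letter₂ : E₂ → A}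
    {src₁ : E₁ × Bool → V₁} {src₂ : E₂ × Bool → V₂} {face₁ : E₁ × Bool → Option F₁}
    {face₂ : E₂ × Bool → Option F₂} {bd₁ : Option F₁ → List (E₁ × Bool)}
    {bd₂ : Option F₂ → List (E₂ × Bool)} {v₁ : V₁} {v₂ : V₂}
    (H₁ : IsDisc R letter₁ src₁ face₁ bd₁ v₁) (H₂ : IsDisc R letter₂ src₂ face₂ bd₂ v₂)
    (x : A × Bool) :
    ∃ (letter : Option (E₁ ⊕ E₂) → A) (src : Option (E₁ ⊕ E₂) × Bool → V₁ ⊕ V₂)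
      (face : Option (E₁ ⊕ E₂) × Bool → Option (F₁ ⊕ F₂))
      (bd : Option (F₁ ⊕ F₂) → List (Option (E₁ ⊕ E₂) × Bool)),
      IsDisc R letter src face bd (Sum.inr v₂) ∧
        (bd none).map (Prod.map letter id) = x :: ((bd₁ none).map (Prod.map letter₁ id) ++
          flip x :: (bd₂ none).map (Prod.map letter₂ id)) := by
  have hfE₁ := H₁.finite_E
  have hfF₁ := H₁.finite_F
  have hfV₁ := H₁.finite_V
  have hfE₂ := H₂.finite_E
  have hfF₂ := H₂.finite_F
  have hfV₂ := H₂.finite_V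
  let i₁ : E₁ × Bool → Option (E₁ ⊕ E₂) × Bool := Prod.map (some ∘ Sum.inl) id
  let i₂ : E₂ × Bool → Option (E₁ ⊕ E₂) × Bool := Prod.map (some ∘ Sum.inr) id
  have hi₁ : Function.Injective i₁ := Function.Injective.prodMap
    ((Option.some_injective _).comp Sum.inl_injective) Function.injective_id
  have hi₂ : Function.Injective i₂ := Function.Injective.prodMap
    ((Option.some_injective _).comp Sum.inr_injective) Function.injective_id
  let e : Option (E₁ ⊕ E₂) × Bool := (none, x.2)
  let letter : Option (E₁ ⊕ E₂) → A := fun o => o.elim x.1 (Sum.elim letter₁ letter₂)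
  let src : Option (E₁ ⊕ E₂) × Bool → V₁ ⊕ V₂ := fun d =>
    d.1.elim (if d.2 = x.2 then Sum.inr v₂ else Sum.inl v₁)
      (Sum.elim (fun a => Sum.inl (src₁ (a, d.2))) fun a => Sum.inr (src₂ (a, d.2)))
  let face : Option (E₁ ⊕ E₂) × Bool → Option (F₁ ⊕ F₂) := fun d =>
    d.1.elim none (Sum.elim (fun a => (face₁ (a, d.2)).map Sum.inl)
      fun a => (face₂ (a, d.2)).map Sum.inr)
  let bd : Option (F₁ ⊕ F₂) → List (Option (E₁ ⊕ E₂) × Bool) := fun o =>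
    o.elim (e :: ((bd₁ none).map i₁ ++ flip e :: (bd₂ none).map i₂))
      (Sum.elim (fun f => (bd₁ (some f)).map i₁) fun f => (bd₂ (some f)).map i₂)
  have hlab₁ : ∀ l : List (E₁ × Bool),
      (l.map i₁).map (Prod.map letter id) = l.map (Prod.map letter₁ id) := fun l => List.map_map
  have hlab₂ : ∀ l : List (E₂ × Bool),
      (l.map i₂).map (Prod.map letter id) = l.map (Prod.map letter₂ id) := fun l => List.map_map
  have hsrc_e : src e = Sum.inr v₂ := if_pos rfl
  have hsrc_e' : src (flip e) = Sum.inl v₁ := if_neg (by simp [e, flip])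
  have hws₁ : ∀ {u v p}, IsWalk src₁ u p v → IsWalk src (Sum.inl u) (p.map i₁) (Sum.inl v) :=
    fun h => (isWalk_map _).2 (h.comp (T := V₁ ⊕ V₂) Sum.inl)
  have hws₂ : ∀ {u v p}, IsWalk src₂ u p v → IsWalk src (Sum.inr u) (p.map i₂) (Sum.inr v) :=
    fun h => (isWalk_map _).2 (h.comp (T := V₁ ⊕ V₂) Sum.inr)
  refine ⟨letter, src, face, bd, ?_, ?_⟩
  · constructor
    · infer_instance
    · infer_instance
    · infer_instance
    · rintro (_ | f | f)
      · refine List.nodup_cons.2 ⟨by simp [e, i₁, i₂, flip], List.nodup_append'.2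
          ⟨(H₁.nodup _).map hi₁, List.nodup_cons.2 ⟨by simp [e, i₂, flip],
            (H₂.nodup _).map hi₂⟩, ?_⟩⟩
        rw [List.disjoint_left]
        intro a ha ha'
        obtain ⟨⟨b, c⟩, -, rfl⟩ := List.mem_map.1 ha
        simp [e, i₁, i₂, flip] at ha'
      · exact (H₁.nodup _).map hi₁
      · exact (H₂.nodup _).map hi₂
    · have hm₁ : ∀ a b (l : List (E₁ × Bool)), (some (Sum.inl a), b) ∈ l.map i₁ ↔ (a, b) ∈ l :=
        fun a b l => List.mem_map_of_injective (f := i₁) (a := (a, b)) hi₁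
      have hm₂ : ∀ a b (l : List (E₂ × Bool)), (some (Sum.inr a), b) ∈ l.map i₂ ↔ (a, b) ∈ l :=
        fun a b l => List.mem_map_of_injective (f := i₂) (a := (a, b)) hi₂
      have hn₁ : ∀ a b (l : List (E₁ × Bool)), (some (Sum.inr a), b) ∉ l.map i₁ := by simp [i₁]
      have hn₂ : ∀ a b (l : List (E₂ × Bool)), (some (Sum.inl a), b) ∉ l.map i₂ := by simp [i₂]
      rintro ⟨_ | a | a, b⟩ (_ | f | f)
      · have := eq_or_eq_flip (a := ((none : Option (E₁ ⊕ E₂)), b)) (d := e) rfl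
        simp only [bd, face, Option.elim, List.mem_cons, List.mem_append]
        tauto
      · simp [bd, face, i₁]
      · simp [bd, face, i₂]
      · simp [bd, face, hm₁, hn₂, e, flip, H₁.mem_bd]
      · simp [bd, face, hm₁, H₁.mem_bd]
      · simp [bd, face, hn₂]
      · simp [bd, face, hn₁, hm₂, e, flip, H₂.mem_bd]
      · simp [bd, face, hn₁]
      · simp [bd, face, hm₂, H₂.mem_bd]
    · rintro (f | f)
      · simpa [bd] using H₁.cell_ne_nil f
      · simpa [bd] using H₂.cell_ne_nil f
    · intro h
      simp [bd] at h
    · refine ⟨hsrc_e, ?_⟩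
      rw [hsrc_e']
      refine (hws₁ H₁.walk_outer).append ⟨hsrc_e', ?_⟩
      rw [flip_flip, hsrc_e]
      exact hws₂ H₂.walk_outer
    · rintro (f | f)
      · obtain ⟨v, hv⟩ := H₁.walk_cell f
        exact ⟨_, hws₁ hv⟩
      · obtain ⟨v, hv⟩ := H₂.walk_cell f
        exact ⟨_, hws₂ hv⟩
    · rintro X t ⟨hX1, hX2⟩ hX
      obtain ⟨t', hX3, hX4, hX5⟩ := isWalk_append.1 hX2
      rw [hX4] at hX3
      rw [flip_flip, hX1] at hX5
      obtain ⟨Y₁, hY₁, hXY₁⟩ := H₁.universal (X ∘ i₁) t' ((isWalk_map _).1 hX3) fun f => by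
        obtain ⟨t, ht⟩ := hX (Sum.inl f)
        exact ⟨t, (isWalk_map _).1 ht⟩
      obtain ⟨Y₂, hY₂, hXY₂⟩ := H₂.universal (X ∘ i₂) t ((isWalk_map _).1 hX5) fun f => by
        obtain ⟨t, ht⟩ := hX (Sum.inr f)
        exact ⟨t, (isWalk_map _).1 ht⟩
      refine ⟨Sum.elim Y₁ Y₂, hY₂, funext ?_⟩
      rintro ⟨_ | a | a, b⟩
      · rcases eq_or_eq_flip (a := ((none : Option (E₁ ⊕ E₂)), b)) (d := e) rfl with h | h <;>
          rw [h]
        · rw [hX1, Function.comp, hsrc_e, Sum.elim_inr, hY₂]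
        · rw [hX4, Function.comp, hsrc_e', Sum.elim_inl, hY₁]
      · exact congrFun hXY₁ (a, b)
      · exact congrFun hXY₂ (a, b)
    · obtain ⟨γ₁, hγ₁⟩ := H₁.paths
      obtain ⟨γ₂, hγ₂⟩ := H₂.paths
      have hmap₁ : ∀ {u v p q}, Homotopic src₁ (fun f => bd₁ (some f)) u v p q →
          Homotopic src (fun f => bd (some f)) (Sum.inl u) (Sum.inl v) (p.map i₁) (q.map i₁) :=
        fun h => h.map (src' := src) (cells' := fun f => bd (some f)) _ Sum.inl Sum.inl rfl
          fun _ => rfl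
      have hmap₂ : ∀ {u v p q}, Homotopic src₂ (fun f => bd₂ (some f)) u v p q →
          Homotopic src (fun f => bd (some f)) (Sum.inr u) (Sum.inr v) (p.map i₂) (q.map i₂) :=
        fun h => h.map (src' := src) (cells' := fun f => bd (some f)) _ Sum.inr Sum.inr rfl
          fun _ => rfl
      let γ : V₁ ⊕ V₂ → List (Option (E₁ ⊕ E₂) × Bool) :=
        Sum.elim (fun v => e :: (γ₁ v).map i₁) fun v => (γ₂ v).map i₂
      have hev : IsWalk src (Sum.inr v₂) [e] (Sum.inl v₁) := ⟨hsrc_e, hsrc_e'⟩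
      have hnew : Homotopic src (fun f => bd (some f)) (Sum.inr v₂) (src (flip e))
          (γ (src e) ++ [e]) (γ (src (flip e))) := by
        rw [hsrc_e, hsrc_e']
        exact ((hmap₂ hγ₂.base).append_right hev).trans ((hmap₁ hγ₁.base).append_left hev).symm
      have hwk : ∀ v, IsWalk src (Sum.inr v₂) (γ v) v := by
        rintro (v | v)
        · exact hev.append (hws₁ (hγ₁.walk v))
        · exact hws₂ (hγ₂.walk v)
      refine ⟨γ, hwk, hmap₂ hγ₂.base, ?_⟩
      rintro ⟨_ | a | a, b⟩
      · rcases eq_or_eq_flip (a := ((none : Option (E₁ ⊕ E₂)), b)) (d := e) rfl with h | h <;>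
          rw [h]
        · exact hnew
        · exact homotopic_flip (hwk _) hnew
      · have := (hmap₁ (hγ₁.edge (a, b))).append_left hev
        rwa [List.map_append] at this
      · have := hmap₂ (hγ₂.edge (a, b))
        rwa [List.map_append] at this
    · have h₁ := H₁.card
      have h₂ := H₂.card
      simp only [Finite.card_option, Nat.card_sum]
      omega
    · rintro (f | f)
      · exact (hlab₁ _).symm ▸ H₁.relator f
      · exact (hlab₂ _).symm ▸ H₂.relator f
  · change (e :: ((bd₁ none).map i₁ ++ flip e :: (bd₂ none).map i₂)).map _ = _
    rw [List.map_cons, List.map_append, List.map_cons, hlab₁, hlab₂]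
    rfl

theorem Fill.exists_isDisc {n k : ℕ} {W : List (A × Bool)} (h : Fill R n k W) :
    ∃ (E V F : Type) (letter : E → A) (src : E × Bool → V) (face : E × Bool → Option F)
      (bd : Option F → List (E × Bool)) (v₀ : V), IsDisc R letter src face bd v₀ ∧
        (bd none).map (Prod.map letter id) = W ∧ Nat.card E = n := by
  induction h with
  | nil => exact ⟨_, _, _, _, _, _, _, _, isDisc_point, rfl, by simp⟩
  | bridge x U V _ _ ih1 ih2 =>
    obtain ⟨E₁, V₁, F₁, l₁, s₁, f₁, b₁, v₁, H₁, rfl, rfl⟩ := ih1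
    obtain ⟨E₂, V₂, F₂, l₂, s₂, f₂, b₂, v₂, H₂, rfl, rfl⟩ := ih2
    obtain ⟨l, s, f, b, H, hW⟩ := H₁.exists_bridge H₂ x
    have := H₁.finite_E
    have := H₂.finite_E
    exact ⟨_, _, _, l, s, f, b, _, H, hW, by simp [Finite.card_option, Nat.card_sum]⟩
  | cell x S W hr _ ih =>
    obtain ⟨E, V, F, l, s, f, b, v, H, hSW, rfl⟩ := ih
    obtain ⟨p, q, hb, rfl, rfl⟩ := List.map_eq_append_iff.1 hSW
    obtain ⟨l', s', f', b', H', hW⟩ := H.exists_add_cell hb x hr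
    have := H.finite_E
    exact ⟨_, _, _, l', s', f', b', _, H', hW, by simp [Finite.card_option]⟩

end Construct

/-! ### Cyclic lists and the permutations they define -/

section Cycles

variable {D : Type*}

theorem exists_isRotated_cons {d : D} {l : List D} (h : d ∈ l) : ∃ t, d :: t ~r l := by
  obtain ⟨p, q, rfl⟩ := List.append_of_mem h
  exact ⟨q ++ p, by simpa using List.isRotated_append (l := d :: q) (l' := p)⟩

variable [DecidableEq D]

theorem iterate_eq_of_formPerm {σ : D → D} {d : D} {t : List D} (hl : (d :: t).Nodup)
    (h : ∀ a ∈ d :: t, σ a = (d :: t).formPerm a) (n : ℕ) :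
    σ^[n] d = (d :: t)[n % (t.length + 1)]'(Nat.mod_lt _ (by simp)) := by
  have key : σ^[n] d = ((d :: t).formPerm ^ n) d := by
    induction n with
    | zero => rfl
    | succ n ih =>
      rw [Function.iterate_succ_apply', ih, h, pow_succ', Equiv.Perm.mul_apply]
      rw [List.formPerm_pow_apply_head _ _ hl]
      exact List.getElem_mem _
  rw [key, List.formPerm_pow_apply_head _ _ hl]
  rfl

/-- Without repetitions in the list, `formPerm` returns to the head only after running through all
of it, so one period of `σ` spells out the list. -/
theorem iterate_minimalPeriod_of_formPerm {σ : D → D} {d : D} {t : List D} (hl : (d :: t).Nodup)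
    (h : ∀ a ∈ d :: t, σ a = (d :: t).formPerm a) :
    List.iterate σ d (Function.minimalPeriod σ d) = d :: t := by
  have hit := iterate_eq_of_formPerm hl h
  have hper : Function.IsPeriodicPt σ (t.length + 1) d := by
    rw [Function.IsPeriodicPt, Function.IsFixedPt, hit]
    simp
  have hmin : Function.minimalPeriod σ d = t.length + 1 := by
    refine le_antisymm (hper.minimalPeriod_le (Nat.succ_pos _)) ?_
    by_contra! hlt
    have h1 := Function.isPeriodicPt_minimalPeriod σ d
    rw [Function.IsPeriodicPt, Function.IsFixedPt, hit] at h1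
    have h2 : (d :: t)[Function.minimalPeriod σ d % (t.length + 1)]'(Nat.mod_lt _ (by simp)) =
      (d :: t)[0] := h1
    rw [hl.getElem_inj_iff, Nat.mod_eq_of_lt hlt] at h2
    exact (hper.minimalPeriod_pos (Nat.succ_pos _)).ne' h2
  rw [hmin]
  refine List.ext_getElem (by simp) fun i hi hi' => ?_
  rw [List.getElem_iterate, hit]
  congr 1
  exact Nat.mod_eq_of_lt (by simpa using hi')

end Cycles

section

variable {E V : Type} [DecidableEq E]

theorem IsWalk.src_formPerm {src : E × Bool → V} {u : V} {l : List (E × Bool)}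
    (h : IsWalk src u l u) (hl : l.Nodup) {d : E × Bool} (hd : d ∈ l) :
    src (l.formPerm d) = src (flip d) := by
  obtain ⟨p, q, rfl⟩ := List.append_of_mem hd
  obtain ⟨w, hw⟩ : ∃ w, IsWalk src w (d :: (q ++ p)) w := isWalk_rotate h
  have hrot : p ++ d :: q ~r d :: (q ++ p) := List.isRotated_append (l := p) (l' := d :: q)
  rw [List.formPerm_eq_of_isRotated hl hrot]
  have hnd := hrot.nodup_iff.1 hl
  generalize q ++ p = t at *
  cases t with
  | nil =>
    rw [List.formPerm_singleton, Equiv.Perm.one_apply]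
    exact hw.1.trans hw.2.symm
  | cons b t =>
    rw [List.formPerm_apply_head _ _ _ hnd]
    exact hw.2.1

/-- A converse of `IsWalk.src_formPerm` for an arbitrary labelling `X` in place of the source map;
it is needed for labellings by rotation orbits. -/
theorem isWalk_of_formPerm {X : E × Bool → V} {d : E × Bool} {t : List (E × Bool)}
    (hl : (d :: t).Nodup) (h : ∀ a ∈ d :: t, X ((d :: t).formPerm a) = X (flip a)) :
    IsWalk X (X d) (d :: t) (X d) := by
  have key : ∀ (q p : List (E × Bool)) (b : E × Bool), d :: t = p ++ b :: q →
      IsWalk X (X b) (b :: q) (X d) := by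
    intro q
    induction q with
    | nil =>
      intro p b hp
      refine ⟨rfl, ?_⟩
      have hb := h b (by rw [hp]; simp)
      have hrot : d :: t ~r b :: p := by
        rw [hp]
        exact List.isRotated_append (l := p) (l' := [b])
      have hnd := hrot.nodup_iff.1 hl
      rw [List.formPerm_eq_of_isRotated hl hrot] at hb
      refine hb.symm.trans (congrArg X ?_)
      cases p with
      | nil =>
        obtain ⟨rfl, rfl⟩ : d = b ∧ t = [] := by simpa using hp
        simp
      | cons c p =>
        obtain ⟨rfl, -⟩ : d = c ∧ t = p ++ [b] := by simpa using hp
        exact List.formPerm_apply_head _ _ _ hnd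
    | cons c q ih =>
      intro p b hp
      refine ⟨rfl, ?_⟩
      have hb := h b (by rw [hp]; simp)
      have hrot : d :: t ~r b :: c :: (q ++ p) := by
        rw [hp]
        exact List.isRotated_append (l := p) (l' := b :: c :: q)
      rw [List.formPerm_eq_of_isRotated hl hrot,
        List.formPerm_apply_head _ _ _ (hrot.nodup_iff.1 hl)] at hb
      rw [← hb]
      exact ih (p ++ [b]) c (by simpa using hp)
  exact key t [] d rfl

end

/-! ### The van Kampen diagram of a disc -/

section

variable {A : Type} {R : Set (List (A × Bool))} {E V F : Type} {letter : E → A}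
  {src : E × Bool → V} {face : E × Bool → Option F} {bd : Option F → List (E × Bool)} {v₀ : V}

namespace IsDisc

open scoped Classical in
theorem formPerm_mem (H : IsDisc R letter src face bd v₀) (d : E × Bool) :
    face ((bd (face d)).formPerm d) = face d := by
  rw [← H.mem_bd, List.formPerm_mem_iff_mem, H.mem_bd]

open scoped Classical in
/-- The permutation of the oriented edges whose cycles are the boundaries of the faces. -/
noncomputable def next (H : IsDisc R letter src face bd v₀) : Equiv.Perm (E × Bool) where
  toFun d := (bd (face d)).formPerm d
  invFun d := (bd (face d)).formPerm⁻¹ d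
  left_inv d := by
    change (bd (face ((bd (face d)).formPerm d))).formPerm⁻¹ ((bd (face d)).formPerm d) = d
    rw [H.formPerm_mem]
    simp
  right_inv d := by
    have : face ((bd (face d)).formPerm⁻¹ d) = face d := by
      rw [← H.mem_bd, ← List.formPerm_mem_iff_mem]
      simp [H.mem_bd]
    change (bd (face ((bd (face d)).formPerm⁻¹ d))).formPerm ((bd (face d)).formPerm⁻¹ d) = d
    rw [this]
    simp

theorem face_next (H : IsDisc R letter src face bd v₀) (d : E × Bool) :
    face (H.next d) = face d := H.formPerm_mem d

open scoped Classical in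
theorem next_eq (H : IsDisc R letter src face bd v₀) {o : Option F} {l : List (E × Bool)}
    (hl : l ~r bd o) {a : E × Bool} (ha : a ∈ l) : H.next a = l.formPerm a := by
  have hm : face a = o := (H.mem_bd a o).1 (hl.mem_iff.1 ha)
  change (bd (face a)).formPerm a = _
  rw [hm, List.formPerm_eq_of_isRotated (hl.nodup_iff.2 (H.nodup o)) hl]

theorem face_eq_iff (H : IsDisc R letter src face bd v₀) (d d' : E × Bool) :
    face d = face d' ↔ H.next.SameCycle d d' := by
  classical
  have := H.finite_E
  constructor
  · intro h
    obtain ⟨t, ht⟩ := exists_isRotated_cons ((H.mem_bd d _).2 rfl)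
    have hd' : d' ∈ d :: t := ht.mem_iff.2 ((H.mem_bd _ _).2 h.symm)
    obtain ⟨i, hi, rfl⟩ := List.getElem_of_mem hd'
    refine ⟨i, ?_⟩
    have := iterate_eq_of_formPerm (σ := H.next) (ht.nodup_iff.2 (H.nodup _))
      (fun a ha => H.next_eq ht ha) i
    rw [zpow_natCast, ← Equiv.Perm.iterate_eq_pow, this]
    congr 1
    exact Nat.mod_eq_of_lt (by simpa using hi)
  · rintro h
    exact (SurfaceComplex.sameCycle_iff (P := fun a => face d = face a)
      (fun x => by rw [H.face_next]) h).1 rfl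

theorem exists_walk (H : IsDisc R letter src face bd v₀) (o : Option F) :
    ∃ v, IsWalk src v (bd o) v := by
  cases o with
  | none => exact ⟨_, H.walk_outer⟩
  | some f => exact H.walk_cell f

theorem src_next (H : IsDisc R letter src face bd v₀) (d : E × Bool) :
    src (H.next d) = src (flip d) := by
  classical
  obtain ⟨v, hv⟩ := H.exists_walk (face d)
  rw [H.next_eq (List.IsRotated.refl _) ((H.mem_bd d _).2 rfl)]
  exact hv.src_formPerm (H.nodup _) ((H.mem_bd d _).2 rfl)

theorem exists_isWalk_of_next (H : IsDisc R letter src face bd v₀) {T : Type} {X : E × Bool → T}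
    (h : ∀ a, X (H.next a) = X (flip a)) {o : Option F} (ho : bd o ≠ []) :
    ∃ t, IsWalk X t (bd o) t := by
  classical
  obtain ⟨d, l, hl⟩ := List.exists_cons_of_ne_nil ho
  have hnd := H.nodup o
  rw [hl] at hnd ⊢
  refine ⟨_, isWalk_of_formPerm hnd fun a ha => ?_⟩
  rw [← h, H.next_eq (o := o) (hl ▸ List.IsRotated.refl _) ha]

/-- The predicate of lying in the rotation orbit of `d` is a labelling for which all face boundaries
close up. By universality it factors through `src`, so oriented edges with the same source lie in
one orbit. -/
theorem src_eq_iff (H : IsDisc R letter src face bd v₀) (d d' : E × Bool) : src d = src d' ↔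
    Equiv.Perm.SameCycle (((Equiv.refl E).prodCongr Equiv.boolNot).trans H.next) d d' := by
  have := H.finite_E
  set ρ : Equiv.Perm (E × Bool) := ((Equiv.refl E).prodCongr Equiv.boolNot).trans H.next with hρ
  have hrot : ∀ a, ρ (flip a) = H.next a := by
    intro a
    simp [hρ, flip]
  constructor
  · intro h
    have hX : ∀ a, ρ.SameCycle d (H.next a) = ρ.SameCycle d (flip a) := fun a => by
      rw [← hrot, Equiv.Perm.sameCycle_apply_right]
    have hE : bd none ≠ [] := fun h => (H.isEmpty h).false d.1
    obtain ⟨t, ht⟩ := H.exists_isWalk_of_next hX hE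
    obtain ⟨Y, -, hY⟩ := H.universal _ t ht fun f =>
      H.exists_isWalk_of_next hX (H.cell_ne_nil f)
    have h1 : ρ.SameCycle d d' = ρ.SameCycle d d := by
      have h2 := congrFun hY d'
      rw [Function.comp, ← h] at h2
      exact h2.trans (congrFun hY d).symm
    rw [h1]
  · intro h
    refine (SurfaceComplex.sameCycle_iff (P := fun a => src d = src a) (fun x => ?_) h).1 rfl
    rw [← flip_flip x, hrot, H.src_next, flip_flip]

/-- The surface complex with the given boundaries of faces. -/
noncomputable def toSurfaceComplex (H : IsDisc R letter src face bd v₀) : SurfaceComplex where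
  V := V
  E := E
  F := F
  finite_V := H.finite_V
  finite_E := H.finite_E
  finite_F := H.finite_F
  src := src
  next := H.next
  face := face
  src_eq_iff := H.src_eq_iff
  face_eq_iff := H.face_eq_iff
  exists_face_eq f := by
    obtain ⟨d, l, hl⟩ := List.exists_cons_of_ne_nil (H.cell_ne_nil f)
    exact ⟨d, (H.mem_bd d _).1 (by simp [hl])⟩
  exists_outer e := by
    have hE : bd none ≠ [] := fun h => (H.isEmpty h).false e
    obtain ⟨d, l, hl⟩ := List.exists_cons_of_ne_nil hE
    exact ⟨d, (H.mem_bd d _).1 (by simp [hl])⟩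

theorem isPath_iff (H : IsDisc R letter src face bd v₀) {u v : V} {p : List (E × Bool)} :
    H.toSurfaceComplex.IsPath u p v ↔ IsWalk src u p v := by
  induction p generalizing u with
  | nil => rfl
  | cons d p ih => exact and_congr_right fun _ => ih

theorem facePath_eq (H : IsDisc R letter src face bd v₀) {o : Option F} {d : E × Bool}
    {t : List (E × Bool)} (h : d :: t ~r bd o) : H.toSurfaceComplex.facePath d = d :: t := by
  classical
  exact iterate_minimalPeriod_of_formPerm (h.nodup_iff.2 (H.nodup o)) fun a ha => H.next_eq h ha

theorem facePath_isRotated (H : IsDisc R letter src face bd v₀) (d : E × Bool) :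
    H.toSurfaceComplex.facePath d ~r bd (face d) := by
  classical
  obtain ⟨t, ht⟩ := exists_isRotated_cons ((H.mem_bd d _).2 rfl)
  rwa [H.facePath_eq ht]

theorem homotopyStep (H : IsDisc R letter src face bd v₀) {u v : V} {p q : List (E × Bool)}
    (h : WalkStep src (fun f => bd (some f)) u v p q) :
    H.toSurfaceComplex.HomotopyStep u v p q := by
  rcases h with ⟨p, q, d, hp, hq⟩ | ⟨p, q, f, w, hp, hf, hq⟩
  · exact .backtrack p q d (H.isPath_iff.2 (hp.append hq))
      (H.isPath_iff.2 ((hp.append (isWalk_pair d)).append hq))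
  · obtain ⟨d, t, ht⟩ := List.exists_cons_of_ne_nil (H.cell_ne_nil f)
    have h1 : H.toSurfaceComplex.facePath d = bd (some f) := by
      rw [ht]
      exact H.facePath_eq (o := some f) (ht ▸ List.IsRotated.refl _)
    have h2 : face d = some f := (H.mem_bd d _).1 (by simp [ht])
    have := SurfaceComplex.HomotopyStep.cell (Δ := H.toSurfaceComplex) (u := u) (v := v) p q d f h2
      (H.isPath_iff.2 (hp.append hq))
      (by rw [h1]; exact H.isPath_iff.2 ((hp.append hf).append hq))
    rwa [h1] at this

/-- The van Kampen diagram with the given boundaries of cells. -/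
noncomputable def toDiagram (H : IsDisc R letter src face bd v₀) : Diagram R where
  toSurfaceComplex := H.toSurfaceComplex
  connected := by
    obtain ⟨γ, hγ⟩ := H.paths
    exact ⟨⟨v₀⟩, fun u v => ⟨_, H.isPath_iff.2 ((hγ.walk u).invRev.append (hγ.walk v))⟩⟩
  simplyConnected := by
    obtain ⟨γ, hγ⟩ := H.paths
    intro v p hp
    exact (hγ.homotopic_nil (H.isPath_iff.1 hp)).mono fun _ _ h => H.homotopyStep h
  planar := H.card
  letter := letter
  relator d f hd := by
    obtain ⟨r, hr, h⟩ := H.relator f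
    have h1 := (H.facePath_isRotated d).map (Prod.map letter id)
    rw [show face d = some f from hd] at h1
    exact ⟨r, hr, h.imp h1.trans h1.trans⟩

end IsDisc

/-- The words with a filling by `n` edges are the boundary labels of the van Kampen diagrams with
`n` edges. -/
theorem exists_diagram_iff {n : ℕ} {W : List (A × Bool)} :
    (∃ Δ : Diagram R, Δ.HasBoundaryLabel W ∧ Δ.numEdges = n) ↔ ∃ k, Fill R n k W := by
  constructor
  · rintro ⟨Δ, hW, rfl⟩
    exact Δ.exists_fill hW
  · rintro ⟨k, h⟩
    obtain ⟨E, V, F, letter, src, face, bd, v₀, H, rfl, rfl⟩ := h.exists_isDisc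
    refine ⟨H.toDiagram, ?_, rfl⟩
    by_cases hb : bd none = []
    · exact Or.inl ⟨H.isEmpty hb, by rw [hb]; rfl⟩
    · obtain ⟨d, t, ht⟩ := List.exists_cons_of_ne_nil hb
      have hd : face d = none := (H.mem_bd d _).1 (by simp [ht])
      refine Or.inr ⟨d, hd, ?_⟩
      have := (H.facePath_isRotated d).map (Prod.map letter id)
      rwa [hd] at this

theorem minEdges_eq {W : List (A × Bool)} : minEdges R W = sInf {n | ∃ k, Fill R n k W} := by
  simp only [minEdges, exists_diagram_iff]

end

/-! ### Computable predicates and lists -/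

section Computability

variable {α β : Type} [Primcodable α] [Primcodable β]

theorem computablePred_comp {p : β → Prop} (hp : ComputablePred p) {f : α → β}
    (hf : Computable f) : ComputablePred fun a => p (f a) := by
  classical
  exact (hp.decide.comp hf).computablePred

theorem computablePred_or {p q : α → Prop} (hp : ComputablePred p) (hq : ComputablePred q) :
    ComputablePred fun a => p a ∨ q a := by
  classical
  exact ((Primrec.or.to_comp.comp hp.decide hq.decide).of_eq (by simp)).computablePred

theorem computablePred_exists_lt {p : α → ℕ → Prop}
    (hp : ComputablePred fun x : α × ℕ => p x.1 x.2) {f : α → ℕ} (hf : Computable f) :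
    ComputablePred fun a => ∃ i < f a, p a i := by
  classical
  have hstep : Computable₂ fun (a : α) (x : ℕ × Bool) => decide (p a x.1) || x.2 :=
    Primrec.or.to_comp.comp
      (hp.decide.comp (Computable.fst.pair (Computable.fst.comp Computable.snd)))
      (Computable.snd.comp Computable.snd)
  refine ((Computable.nat_rec hf (Computable.const false) hstep).of_eq
    fun a => ?_).computablePred
  generalize f a = n
  induction n with
  | zero => simp
  | succ n ih =>
    simp only [ih, ← Bool.decide_or, Nat.lt_succ_iff_lt_or_eq, decide_eq_decide]
    constructor
    · rintro (h | ⟨i, hi, h⟩)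
      · exact ⟨n, Or.inr rfl, h⟩
      · exact ⟨i, Or.inl hi, h⟩
    · rintro ⟨i, hi | rfl, h⟩
      · exact Or.inr ⟨i, hi, h⟩
      · exact Or.inl h

/-- The elements with code less than `n` of a computable set can be listed. -/
theorem exists_computable_list {p : α → Prop} (hp : ComputablePred p) :
    ∃ L : ℕ → List α, Computable L ∧ ∀ n a, a ∈ L n ↔ Encodable.encode a < n ∧ p a := by
  classical
  let g : α → List α := fun a => if p a then [a] else []
  have hg : Computable g :=
    (Computable.cond hp.decide (Primrec.list_cons.to_comp.comp Computable.id (Computable.const []))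
      (Computable.const [])).of_eq fun a => by by_cases h : p a <;> simp [g, h]
  -- `decode₂` succeeds only on genuine codes, so each element is listed at its own code.
  let d : ℕ → List α := fun i => ((Encodable.decode₂ α i).map g).getD []
  have hd : Computable d :=
    Computable.option_getD
      (Computable.option_map Primrec.decode₂.to_comp (hg.comp Computable.snd).to₂)
      (Computable.const [])
  have hstep : Computable₂ fun (_ : ℕ) (y : ℕ × List α) => d y.1 ++ y.2 :=
    Computable.list_append.comp (hd.comp (Computable.fst.comp Computable.snd))
      (Computable.snd.comp Computable.snd)
  refine ⟨fun n => Nat.rec [] (fun i l => d i ++ l) n,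
    Computable.nat_rec Computable.id (Computable.const []) hstep, fun n a => ?_⟩
  induction n with
  | zero => simp
  | succ n ih =>
    have h1 : a ∈ d n ↔ Encodable.encode a = n ∧ p a := by
      simp only [d]
      cases h : Encodable.decode₂ α n with
      | none =>
        have : Encodable.encode a ≠ n := fun h' => by
          rw [← h', Encodable.encodek₂] at h
          exact absurd h (by simp)
        simp [this]
      | some b =>
        have hb : Encodable.encode b = n := Encodable.mem_decode₂.1 h
        by_cases hpb : p b
        · have : a = b ↔ Encodable.encode a = n := by
            rw [← hb, Encodable.encode_inj]
          simp only [Option.map_some, Option.getD_some, g, if_pos hpb, List.mem_singleton]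
          constructor
          · rintro rfl
            exact ⟨hb, hpb⟩
          · exact fun h => this.2 h.1
        · simp only [Option.map_some, Option.getD_some, g, if_neg hpb, List.not_mem_nil, false_iff]
          rintro ⟨h1, h2⟩
          rw [← hb, Encodable.encode_inj] at h1
          exact hpb (h1 ▸ h2)
    simp only [List.mem_append, h1, ih, Nat.lt_succ_iff_lt_or_eq]
    tauto

/-- The code of a nonempty list is one more than the `Nat.pair` of the codes of head and tail. Since
pairing is monotone, a bound `M` for the codes of letters gives a recursion for `B`, and all words
of length at most `n` are found among the codes below `B n`. -/
theorem exists_code_bound (α : Type) [Primcodable α] [Finite α] :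
    ∃ B : ℕ → ℕ, Computable B ∧ ∀ l : List α, ∀ n, l.length ≤ n → Encodable.encode l < B n := by
  obtain ⟨M, hM⟩ : ∃ M, ∀ a : α, Encodable.encode a ≤ M :=
    (Set.finite_range (Encodable.encode : α → ℕ)).bddAbove.imp fun _ h a => h ⟨a, rfl⟩
  refine ⟨fun n => Nat.rec 1 (fun _ b => (Nat.pair M b).succ.succ) n,
    (Primrec.nat_rec' Primrec.id (Primrec.const 1) (Primrec.succ.comp (Primrec.succ.comp
      (Primrec₂.natPair.comp (Primrec.const M)
        (Primrec.snd.comp Primrec.snd)))).to₂).to_comp, fun l n => ?_⟩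
  induction n generalizing l with
  | zero =>
    intro h
    rw [List.eq_nil_of_length_eq_zero (Nat.le_zero.1 h)]
    simp
  | succ n ih =>
    intro h
    cases l with
    | nil => simp
    | cons a l =>
      have h1 := ih l (by simpa using h)
      rw [Encodable.encode_list_cons]
      refine Nat.succ_lt_succ (Nat.lt_succ_of_lt ?_)
      calc Nat.pair (Encodable.encode a) (Encodable.encode l)
          < Nat.pair (Encodable.encode a) _ := Nat.pair_lt_pair_right _ h1
        _ ≤ Nat.pair M _ := by
          rcases (hM a).lt_or_eq with h | h
          · exact (Nat.pair_lt_pair_left _ h).le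
          · rw [h]

end Computability

/-! ### Enumeration of fillings and the two algorithms -/

section Enumeration

variable {m : ℕ} {R : Set (List (Fin m × Bool))}

theorem primrec_flip : Primrec (flip : Fin m × Bool → Fin m × Bool) :=
  Primrec.fst.pair (Primrec.not.comp Primrec.snd)

theorem computablePred_cyclicRelators (hR : ComputablePred fun W => W ∈ R) :
    ComputablePred fun W => W ∈ cyclicRelators R := by
  have hinv : Primrec (FreeGroup.invRev : List (Fin m × Bool) → List (Fin m × Bool)) :=
    Primrec.list_reverse.comp (Primrec.list_map Primrec.id (primrec_flip.comp Primrec.snd).to₂)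
  have hrot : Primrec fun x : List (Fin m × Bool) × ℕ => x.1.drop x.2 ++ x.1.take x.2 :=
    Primrec.list_append.comp (Primrec.list_drop.comp Primrec.snd Primrec.fst)
      (Primrec.list_take.comp Primrec.snd Primrec.fst)
  refine (computablePred_exists_lt (p := fun W i => W.drop i ++ W.take i ∈ R ∨
    FreeGroup.invRev (W.drop i ++ W.take i) ∈ R) (computablePred_or (computablePred_comp hR hrot.to_comp)
    (computablePred_comp hR (hinv.comp hrot).to_comp))
    -- Rotations by `i ≤ |W|` give all cyclic conjugates; with the strict bound `|W| + 1` the empty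
    -- word also has one.
    (Primrec.succ.comp Primrec.list_length).to_comp).of_eq fun W => ?_
  constructor
  · rintro ⟨i, hi, h⟩
    rw [← List.rotate_eq_drop_append_take (Nat.lt_succ_iff.1 hi)] at h
    have hW : W ~r W.rotate i := ⟨i, rfl⟩
    rcases h with h | h
    · exact ⟨_, h, Or.inl hW⟩
    · exact ⟨_, h, Or.inr (by rwa [FreeGroup.invRev_invRev])⟩
  · rintro ⟨r, hr, h | h⟩
    all_goals
      obtain ⟨i, hi, h⟩ := List.isRotated_iff_mod.1 h
      refine ⟨i, Nat.lt_succ_of_le hi, ?_⟩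
      rw [← List.rotate_eq_drop_append_take hi, h]
    · exact Or.inl hr
    · exact Or.inr (by rwa [FreeGroup.invRev_invRev])

/-- The pairs `(n, W)` obtained from the list `H` by one application of the rules for `Fill`, with
relators from the list `C`. -/
noncomputable def fillStep (C : List (List (Fin m × Bool))) (H : List (ℕ × List (Fin m × Bool))) :
    List (ℕ × List (Fin m × Bool)) :=
  (H.flatMap fun a => H.flatMap fun b => (Finset.univ : Finset (Fin m × Bool)).toList.map fun x =>
    (a.1 + b.1 + 1, x :: (a.2 ++ flip x :: b.2))) ++
  H.flatMap fun a => (List.range (a.2.length + 1)).flatMap fun j =>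
    ((Finset.univ : Finset (Fin m × Bool)).toList.filter fun x =>
      flip x :: a.2.take j ∈ C).map fun x => (a.1 + 1, x :: a.2.drop j)

/-- The pairs `(n, W)` obtained by at most `t` rounds of applications of the rules for `Fill`. -/
noncomputable def fillList (C : List (List (Fin m × Bool))) (t : ℕ) : List (ℕ × List (Fin m × Bool)) :=
  Nat.rec [(0, [])] (fun _ H => H ++ fillStep C H) t

theorem mem_fillStep {C : List (List (Fin m × Bool))} {H : List (ℕ × List (Fin m × Bool))}
    {q : ℕ × List (Fin m × Bool)} : q ∈ fillStep C H ↔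
      (∃ n U n' V x, (n, U) ∈ H ∧ (n', V) ∈ H ∧ q = (n + n' + 1, x :: (U ++ flip x :: V))) ∨
      ∃ n S W x, (n, S ++ W) ∈ H ∧ flip x :: S ∈ C ∧ q = (n + 1, x :: W) := by
  unfold fillStep
  rw [List.mem_append]
  refine or_congr ?_ ?_
  · simp only [List.mem_flatMap, List.mem_map, Finset.mem_toList, Finset.mem_univ, true_and]
    constructor
    · rintro ⟨⟨n, U⟩, hU, ⟨n', V⟩, hV, x, rfl⟩
      exact ⟨n, U, n', V, x, hU, hV, rfl⟩
    · rintro ⟨n, U, n', V, x, hU, hV, rfl⟩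
      exact ⟨_, hU, _, hV, x, rfl⟩
  · simp only [List.mem_flatMap, List.mem_map, List.mem_filter, Finset.mem_toList,
      Finset.mem_univ, true_and, List.mem_range, decide_eq_true_eq]
    constructor
    · rintro ⟨⟨n, Y⟩, hY, j, -, x, hx, rfl⟩
      exact ⟨n, Y.take j, Y.drop j, x, by rwa [List.take_append_drop], hx, rfl⟩
    · rintro ⟨n, S, W, x, hY, hx, rfl⟩
      exact ⟨_, hY, S.length, by simp, x, by simpa using hx, by simp⟩

theorem fill_of_mem_fillList {C : List (List (Fin m × Bool))}
    (hC : ∀ w ∈ C, w ∈ cyclicRelators R) (t : ℕ) :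
    ∀ q ∈ fillList C t, ∃ k, Fill R q.1 k q.2 := by
  induction t with
  | zero =>
    intro q hq
    obtain rfl : q = (0, []) := List.mem_singleton.1 hq
    exact ⟨0, Fill.nil⟩
  | succ t ih =>
    intro q hq
    rcases List.mem_append.1 hq with hq | hq
    · exact ih q hq
    · rcases mem_fillStep.1 hq with ⟨n, U, n', V, x, hU, hV, rfl⟩ | ⟨n, S, W, x, hY, hS, rfl⟩
      · obtain ⟨k, hk⟩ := ih _ hU
        obtain ⟨k', hk'⟩ := ih _ hV
        exact ⟨_, Fill.bridge x U V hk hk'⟩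
      · obtain ⟨k, hk⟩ := ih _ hY
        exact ⟨_, Fill.cell x S W (hC _ hS) hk⟩

theorem fillList_mono (C : List (List (Fin m × Bool))) {t t' : ℕ} (h : t ≤ t') :
    fillList C t ⊆ fillList C t' := by
  induction h with
  | refl => exact List.Subset.refl _
  | step _ ih => exact List.Subset.trans ih (List.subset_append_left _ _)

/-- Each rule adds an edge, so `n` rounds suffice for `n` edges. The relator of a cell has all but
one of its letters on the boundary of a filling with fewer than `N` edges, so its length is at most
`2 * N`. -/
theorem mem_fillList_of_fill {C : List (List (Fin m × Bool))} {N : ℕ}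
    (hC : ∀ w ∈ cyclicRelators R, w.length ≤ 2 * N → w ∈ C) {n k : ℕ} {W : List (Fin m × Bool)}
    (h : Fill R n k W) (hn : n ≤ N) : (n, W) ∈ fillList C n := by
  induction h with
  | nil => exact List.mem_singleton.2 rfl
  | bridge x U V _ _ ih1 ih2 =>
    refine List.mem_append_right _ (mem_fillStep.2 (Or.inl ⟨_, U, _, V, x, ?_, ?_, rfl⟩))
    · exact fillList_mono C (by omega) (ih1 (by omega))
    · exact fillList_mono C (by omega) (ih2 (by omega))
  | cell x S W hr h ih =>
    refine List.mem_append_right _ (mem_fillStep.2 (Or.inr ⟨_, S, W, x, ih (by omega), ?_, rfl⟩))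
    have := h.length_le
    rw [List.length_append] at this
    exact hC _ hr (by rw [List.length_cons]; omega)

theorem primrec_fillStep : Primrec₂ (fillStep (m := m)) := by
  have hl : ∀ {γ : Type} [Primcodable γ],
      Primrec fun _ : γ => (Finset.univ : Finset (Fin m × Bool)).toList := Primrec.const _
  refine Primrec.list_append.comp ?_ ?_
  · refine Primrec.list_flatMap Primrec.snd (Primrec.list_flatMap (Primrec.snd.comp Primrec.fst)
      (Primrec.list_map hl ?_))
    have ha : Primrec fun y : (((List (List (Fin m × Bool)) × List (ℕ × List (Fin m × Bool))) ×
        (ℕ × List (Fin m × Bool))) × (ℕ × List (Fin m × Bool))) × (Fin m × Bool) => y.1.1.2 :=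
      Primrec.snd.comp (Primrec.fst.comp Primrec.fst)
    have hb : Primrec fun y : (((List (List (Fin m × Bool)) × List (ℕ × List (Fin m × Bool))) ×
        (ℕ × List (Fin m × Bool))) × (ℕ × List (Fin m × Bool))) × (Fin m × Bool) => y.1.2 :=
      Primrec.snd.comp Primrec.fst
    exact Primrec.pair
      (Primrec.succ.comp (Primrec.nat_add.comp (Primrec.fst.comp ha) (Primrec.fst.comp hb)))
      (Primrec.list_cons.comp Primrec.snd (Primrec.list_append.comp (Primrec.snd.comp ha)
        (Primrec.list_cons.comp (primrec_flip.comp Primrec.snd) (Primrec.snd.comp hb))))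
  · have hr : Primrec fun y : (List (List (Fin m × Bool)) × List (ℕ × List (Fin m × Bool))) ×
        (ℕ × List (Fin m × Bool)) => List.range (y.2.2.length + 1) :=
      Primrec.list_range.comp (Primrec.succ.comp (Primrec.list_length.comp
        (Primrec.snd.comp Primrec.snd)))
    have hmem : PrimrecRel fun (w : List (Fin m × Bool)) C => w ∈ C :=
      (PrimrecRel.exists_mem_list (R := fun a b : List (Fin m × Bool) => a = b)
        Primrec.eq).swap.of_eq fun w C => by simp [Function.swap]
    refine Primrec.list_flatMap Primrec.snd (Primrec.list_flatMap hr (Primrec.list_map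
      (f := fun y : (((List (List (Fin m × Bool)) × List (ℕ × List (Fin m × Bool))) ×
        (ℕ × List (Fin m × Bool))) × ℕ) => (Finset.univ : Finset (Fin m × Bool)).toList.filter
          fun x => flip x :: y.1.2.2.take y.2 ∈ y.1.1.1) ?_ ?_))
    · refine (PrimrecRel.listFilter (R := fun (x : Fin m × Bool)
        (y : ((List (List (Fin m × Bool)) × List (ℕ × List (Fin m × Bool))) ×
        (ℕ × List (Fin m × Bool))) × ℕ) => flip x :: y.1.2.2.take y.2 ∈ y.1.1.1) ?_).comp hl
          Primrec.id
      have h2 : Primrec fun z : (Fin m × Bool) × (((List (List (Fin m × Bool)) ×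
          List (ℕ × List (Fin m × Bool))) × (ℕ × List (Fin m × Bool))) × ℕ) => z.2.1 :=
        Primrec.fst.comp Primrec.snd
      exact hmem.comp (Primrec.list_cons.comp (primrec_flip.comp Primrec.fst)
        (Primrec.list_take.comp (Primrec.snd.comp Primrec.snd)
          (Primrec.snd.comp (Primrec.snd.comp h2)))) (Primrec.fst.comp (Primrec.fst.comp h2))
    · have h2 : Primrec fun z : (((List (List (Fin m × Bool)) × List (ℕ × List (Fin m × Bool))) ×
          (ℕ × List (Fin m × Bool))) × ℕ) × (Fin m × Bool) => z.1.1.2 :=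
        Primrec.snd.comp (Primrec.fst.comp Primrec.fst)
      exact Primrec.pair (Primrec.succ.comp (Primrec.fst.comp h2))
        (Primrec.list_cons.comp Primrec.snd (Primrec.list_drop.comp
          (Primrec.snd.comp Primrec.fst) (Primrec.snd.comp h2)))

theorem primrec_fillList : Primrec₂ (fillList (m := m)) := by
  refine Primrec.nat_rec' (f := fun y : List (List (Fin m × Bool)) × ℕ => y.2)
    (h := fun y z => z.2 ++ fillStep y.1 z.2) Primrec.snd (Primrec.const _) ?_
  have h : Primrec fun z : (List (List (Fin m × Bool)) × ℕ) ×
      (ℕ × List (ℕ × List (Fin m × Bool))) => z.2.2 := Primrec.snd.comp Primrec.snd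
  exact Primrec.list_append.comp h
    (primrec_fillStep.comp (Primrec.fst.comp Primrec.fst) h)

/-- There is an algorithm that lists, for given `N`, the words that bound diagrams with at most
`N` edges. -/
theorem exists_computable_fillList (hR : ComputablePred fun W => W ∈ R) :
    ∃ T : ℕ → List (ℕ × List (Fin m × Bool)), Computable T ∧
      ∀ N W, (∃ q ∈ T N, q.1 ≤ N ∧ q.2 = W) ↔ ∃ n ≤ N, ∃ k, Fill R n k W := by
  obtain ⟨L, hL, hmem⟩ := exists_computable_list (computablePred_cyclicRelators hR)
  obtain ⟨B, hB, hlt⟩ := exists_code_bound (Fin m × Bool)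
  -- `N` rounds can also produce diagrams with more than `N` edges, whence the test `q.1 ≤ N`.
  refine ⟨fun N => fillList (L (B (2 * N))) N, primrec_fillList.to_comp.comp
    (hL.comp (hB.comp (Primrec.nat_mul.comp (Primrec.const 2) Primrec.id).to_comp))
    Computable.id, fun N W => ?_⟩
  constructor
  · rintro ⟨⟨n, _⟩, hq, hn, rfl⟩
    exact ⟨n, hn, fill_of_mem_fillList (fun w hw => ((hmem _ _).1 hw).2) N _ hq⟩
  · rintro ⟨n, hn, k, h⟩
    refine ⟨(n, W), fillList_mono _ hn (mem_fillList_of_fill (N := N) (fun w hw hlen => ?_) h hn),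
      hn, rfl⟩
    exact (hmem _ _).2 ⟨hlt w _ hlen, hw⟩

theorem minEdges_le_iff {W : List (Fin m × Bool)} (hW : IsConsequence R W) (N : ℕ) :
    minEdges R W ≤ N ↔ ∃ n ≤ N, ∃ k, Fill R n k W := by
  have hne : {n | ∃ k, Fill R n k W}.Nonempty := isConsequence_iff_exists_fill.1 hW
  rw [minEdges_eq]
  constructor
  · exact fun h => ⟨_, h, Nat.sInf_mem hne⟩
  · rintro ⟨n, hn, h⟩
    exact (Nat.sInf_le h).trans hn

/-- As the alphabet is finite, the supremum is over a bounded set, nonempty because of the empty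
word; and a consequence has some filling. So the default values of `sSup` and `sInf` do not
interfere. -/
theorem dehnOne_le_iff (x N : ℕ) : dehnOne R x ≤ N ↔
    ∀ W, IsConsequence R W → W.length ≤ x → ∃ n ≤ N, ∃ k, Fill R n k W := by
  have hfin : {W : List (Fin m × Bool) | W.length ≤ x}.Finite := List.finite_length_le _ x
  have hbdd : BddAbove {n | ∃ W : List (Fin m × Bool), IsConsequence R W ∧ W.length ≤ x ∧
      minEdges R W = n} := by
    refine ((hfin.image (minEdges R)).subset ?_).bddAbove
    rintro _ ⟨W, -, hW, rfl⟩
    exact ⟨W, hW, rfl⟩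
  have hne : {n | ∃ W : List (Fin m × Bool), IsConsequence R W ∧ W.length ≤ x ∧
      minEdges R W = n}.Nonempty := ⟨_, [], one_mem _, by simp, rfl⟩
  constructor
  · intro h W hW hx
    exact (minEdges_le_iff hW N).1 ((le_csSup hbdd ⟨W, hW, hx, rfl⟩).trans h)
  · intro h
    refine csSup_le hne ?_
    rintro _ ⟨W, hW, hx, rfl⟩
    exact (minEdges_le_iff hW N).2 (h W hW hx)

/-- The value `f₁(|W|)` bounds the search for a diagram with boundary `W`; if none is found, `W` is
not a consequence. -/
theorem isConsequence_computable_of_dehnOne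
    (hdec : ComputablePred fun W : List (Fin m × Bool) => W ∈ R)
    (h : Computable (dehnOne R)) : ComputablePred fun W => IsConsequence R W := by
  obtain ⟨T, hT, hmem⟩ := exists_computable_fillList hdec
  have hrel : PrimrecRel fun (q : ℕ × List (Fin m × Bool)) (y : ℕ × List (Fin m × Bool)) =>
      q.1 ≤ y.1 ∧ q.2 = y.2 :=
    (Primrec.nat_le.comp (Primrec.fst.comp Primrec.fst) (Primrec.fst.comp Primrec.snd)).and
      (Primrec.eq.comp (Primrec.snd.comp Primrec.fst) (Primrec.snd.comp Primrec.snd))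
  have hlen : Computable fun W : List (Fin m × Bool) => dehnOne R W.length :=
    h.comp Computable.list_length
  refine (computablePred_comp (PrimrecPred.computablePred hrel.exists_mem_list)
    ((hT.comp hlen).pair (hlen.pair Computable.id))).of_eq fun W => ?_
  refine (hmem _ W).trans ⟨?_, fun hW => ?_⟩
  · rintro ⟨n, -, k, h⟩
    exact isConsequence_iff_exists_fill.2 ⟨n, k, h⟩
  · exact (dehnOne_le_iff _ _).1 le_rfl W hW le_rfl

theorem dehnOne_computable_of_isConsequence
    (hdec : ComputablePred fun W : List (Fin m × Bool) => W ∈ R)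
    (h : ComputablePred fun W => IsConsequence R W) : Computable (dehnOne R) := by
  classical
  obtain ⟨T, hT, hmem⟩ := exists_computable_fillList hdec
  obtain ⟨L, hL, hLmem⟩ := exists_computable_list h
  obtain ⟨B, hB, hlt⟩ := exists_code_bound (Fin m × Bool)
  have hrel : PrimrecRel fun (q : ℕ × List (Fin m × Bool)) (y : ℕ × List (Fin m × Bool)) =>
      q.1 ≤ y.1 ∧ q.2 = y.2 :=
    (Primrec.nat_le.comp (Primrec.fst.comp Primrec.fst) (Primrec.fst.comp Primrec.snd)).and
      (Primrec.eq.comp (Primrec.snd.comp Primrec.fst) (Primrec.snd.comp Primrec.snd))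
  have hrel2 : PrimrecRel fun (W : List (Fin m × Bool))
      (y : ℕ × ℕ × List (ℕ × List (Fin m × Bool))) =>
      ¬ W.length ≤ y.1 ∨ ∃ q ∈ y.2.2, q.1 ≤ y.2.1 ∧ q.2 = W := by
    refine PrimrecPred.or (PrimrecPred.not (Primrec.nat_le.comp
      (Primrec.list_length.comp Primrec.fst) (Primrec.fst.comp Primrec.snd))) ?_
    have h2 : Primrec fun z : List (Fin m × Bool) × (ℕ × ℕ × List (ℕ × List (Fin m × Bool))) =>
        z.2.2 := Primrec.snd.comp Primrec.snd
    exact hrel.exists_mem_list.comp (Primrec.snd.comp h2)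
      ((Primrec.fst.comp h2).pair Primrec.fst)
  -- The list `L (B x)` contains every consequence of length at most `x`, but longer ones as well;
  -- these are let through by the first alternative.
  have key : ∀ x N, (∀ W ∈ L (B x), ¬ W.length ≤ x ∨ ∃ q ∈ T N, q.1 ≤ N ∧ q.2 = W) ↔
      dehnOne R x ≤ N := by
    intro x N
    rw [dehnOne_le_iff]
    simp only [hmem, hLmem]
    constructor
    · exact fun h W hW hx => (h W ⟨hlt W x hx, hW⟩).resolve_left (not_not.2 hx)
    · exact fun h W hW => or_iff_not_imp_left.2 fun hx => h W hW.2 (not_not.1 hx)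
  have hP : ComputablePred fun z : ℕ × ℕ => dehnOne R z.1 ≤ z.2 :=
    (computablePred_comp (PrimrecPred.computablePred hrel2.forall_mem_list)
      ((hL.comp (hB.comp Computable.fst)).pair
        (Computable.fst.pair (Computable.snd.pair (hT.comp Computable.snd))))).of_eq
      fun z => key z.1 z.2
  -- The value is the least `N` for which the decidable bound holds, found by unbounded search.
  refine (Computable.find hP fun x => ⟨_, le_rfl⟩).of_eq fun x => ?_
  exact (Nat.find_eq_iff _).2 ⟨le_rfl, fun n hn => not_le.2 hn⟩

end Enumeration

end VanKampen

theorem theorem1p2 (m : ℕ) (R : Set (List (Fin m × Bool)))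
    (hne : ∀ r ∈ R, r ≠ []) (hred : ∀ r ∈ R, FreeGroup.IsCyclicallyReduced r)
    (hdec : ComputablePred fun W : List (Fin m × Bool) => W ∈ R) :
    (ComputablePred fun W : List (Fin m × Bool) => VanKampen.IsConsequence R W) ↔
      Computable (VanKampen.dehnOne R) :=
  ⟨VanKampen.dehnOne_computable_of_isConsequence hdec,
    VanKampen.isConsequence_computable_of_dehnOne hdec⟩
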